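/- **Model.** Let $\lambda,\mu,\rho,\theta_{SR},\theta_{Tx}>0$, $\eta>2$, $\sigma^2\ge 0$, $a\in[0,1]$, $\bar a=1-a$, and let $n_Z,q,N\ge 1$ be integers; put $\tilde\mu=\mu/n_Z$, $c=3.575$. A vector $\varphi=(\varphi_{RA},\varphi_{Tx_1},\dots,\varphi_{Tx_N})$ is called a *load* if its entries are nonnegative and $\varphi\mathbf e\le 1$, where $\mathbf e$ is the all-ones column. For $m\ge0$ let $p_m(n)=\frac{\Gamma(n+c)}{\Gamma(n+1)\Gamma(c)}\frac{m^n(\lambda c)^c}{(m+\lambda c)^{n+c}}$, $n=0,1,2,\dots$. With $F(z)={}_2F_1(1,1-\frac2\eta;2-\frac2\eta;-z)$, define $$P_{RA}=\sum_{n\ge0}p_{\varphi_{RA}\tilde\mu}(n)\,\frac1{n+1}\sum_{k=1}^{n+1}\binom{n+1}{k}(-1)^{k+1}e^{-k\theta_{SR}\sigma^2/\rho}\,e^{-2k\theta_{SR}\frac{\varphi_{RA}\tilde\mu}{\lambda}\frac{F(k\theta_{SR})}{\eta-2}}\,L_n(k),$$ $$L_0(k)=1,\qquad L_n(k)=\frac{n+1}{1+k\theta_{SR}}\Big(\frac1n-\frac{\Gamma(n)\Gamma(2+k\theta_{SR})}{\Gamma(2+n+k\theta_{SR})}\Big)\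 (n\ge1),$$ $$P_{Tx}=\exp\Big(-\frac{\sigma^2\theta_{Tx}}\rho-\frac{2\theta_{Tx}}{\eta-2}F(\theta_{Tx})\Big),\qquad P_{aval}=\sum_{n=0}^{q-1}p_{m}(n),\quad m=\mu\sum_{k=1}^{N-1}\varphi_{Tx_k}.$$ On phases $0$ (RA) and $1,\dots,N$ (Tx$_k$), let $S_{00}=1-P_{RA}P_{aval}$, $S_{01}=P_{RA}P_{aval}$, $S_{k,k+1}=1-P_{Tx}$ and $G_{k,k+1}=P_{Tx}$ for $1\le k\le N$ (with $N+1$ read as $0$), all other entries being $0$. The queue of a device is the Markov chain on {idle} $\cup$ {(level $i\ge1$, phase)} with idle→idle probability $\bar a$, idle→level 1 row $\mathbf C=(a,0,\dots,0)$, level 1→idle column $\bar a(\mathbf e-S\mathbf e)$, and blocks $A_0=aS$ (up), $A_1=aG+\bar aS$ (same level), $A_2=\bar aG$ (down). A *steady state* is a pair $(x_0,\varphi)$, $\varphi$ a load, such that the chain whose $P_{RA},P_{Tx},P_{aval}$ are evaluated at $\varphi$ has a stationary distribution with idle probability $x_0$ and phase occupancies (summed over all levels $i\ge1$) $\varphi$.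 **Algorithms.** *Algorithm 1* (tolerance $\delta$): $R_{[0]}=0$, $R_{[m+1]}=A_0+R_{[m]}A_1+R_{[m]}^2A_2$, stopped at the first iterate that differs from its predecessor by less than $\delta$ in every entry. *Algorithm 2* (tolerances $\varepsilon$, $\delta$): from the current load $\varphi$ compute $P_{RA},P_{Tx},P_{aval}$, $S$, $G$ and $\nu$, where $r=P_{RA}P_{aval}$, $\nu_0=1/(1+Nr)$, $\nu_k=\nu_0r$ for $k\ge1$; if $\nu\bar aG\mathbf e>\nu aS\mathbf e$ fails, return "unstable"; otherwise compute $R$ by Algorithm 1, $x_1=x_0^R\,\mathbf C M^{-1}$ with $M=I-A_1-RA_2$ and $x_0^R=\big(1+\mathbf CM^{-1}(I-R)^{-1}\mathbf e\big)^{-1}$, and replace $\varphi$ by $x_1(I-R)^{-1}$; stop when every entry changes by less than $\varepsilon$, returning $R$, $\varphi$ and $x_0=1-\varphi\mathbf e$. An *exact pass* is a pass whose stability check succeeds, carried out with $R$ the minimal nonnegative solution of $R=A_0+RA_1+R^2A_2$. **Theorem 1.** 1. For every load $\varphi$: $p_{\varphi_{RA}\tilde\mu}$ is a probability distribution, the series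 for $P_{RA}$ converges, $P_{RA},P_{aval}\in(0,1]$, $P_{Tx}\in(0,1)$; $\nu$ is the unique solution of $\nu(A_0+A_1+A_2)=\nu$, $\nu\mathbf e=1$; and the check $\nu\bar aG\mathbf e>\nu aS\mathbf e$ succeeds if and only if the chain has a stationary distribution. 2. If the check succeeds at the load $\varphi$, then Algorithm 1 terminates for every $\delta>0$, the pass of Algorithm 2 again yields a load, with $\varphi\mathbf e<1$, and there is a minimal nonnegative solution $R$ such that $R_{[m]}\to R$ and, as $\delta\downarrow0$, the output of Algorithm 1 tends to $R$ and the result of the pass tends to that of the exact pass. Moreover $I-R$ and $M$ are invertible, the chain has exactly one stationary distribution, and this has idle probability $x_0^R>0$, level probabilities $x_i=x_1R^{i-1}$ and phase occupancies $\varphi'=\sum_{i\ge1}x_i=x_1(I-R)^{-1}$, a load with $x_0^R=1-\varphi'\mathbf e$. 3. For a load $\varphi$, $(x_0,\varphi)$ is a steady state if and only if the exact pass maps $\varphi$ to itself and $x_0=1-\varphi\mathbf e$. 4. If exact passes started from a load $\varphi_{[0]}$ are always stable and converge to $\varphi$, then $(1-\varphi\mathbf e,\varphi)$ is a steady state, unless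 $\varphi\mathbf e=1$ and the check fails at $\varphi$. In either case, for every $\tau>0$, for all sufficiently small $\varepsilon>0$ and then all sufficiently small $\delta>0$ (depending on $\varepsilon$), Algorithm 2 started from $\varphi_{[0]}$ terminates and returns values within $\tau$ of $\varphi$ and $1-\varphi\mathbf e$. 5. If Algorithm 2, started from arbitrary loads with tolerances $\varepsilon_k,\delta_k>0$, $\varepsilon_k,\delta_k\to0$, returns $(R_k,\varphi_k,x_{0,k})$ with $\varphi_k\to\varphi$, then $x_{0,k}\to1-\varphi\mathbf e$, and either $(1-\varphi\mathbf e,\varphi)$ is a steady state and $R_k$ tends to the minimal nonnegative solution at $\varphi$, or $\varphi\mathbf e=1$ and the check fails at $\varphi$. -/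

import Mathlib

open Filter Topology Matrix

noncomputable section

namespace SCUL

/-- Parameters of the scheduled-uplink (SC-UL) network: intensities `lam` of base stations and `mu`
of devices, path-loss exponent `eta`, power-control threshold `rho`, noise power `sigma2`, detection
thresholds `thSR` (scheduling requests) and `thTx` (data), arrival probability `a` per slot, number
`nZ` of preamble sequences, number `q` of resource blocks, number `N` of granted slots. -/
structure Network where
  lam : ℝ
  mu : ℝ
  eta : ℝ
  rho : ℝ
  sigma2 : ℝ
  thSR : ℝ
  thTx : ℝ
  a : ℝ
  nZ : ℕ
  q : ℕ
  N : ℕ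
  lam_pos : 0 < lam
  mu_pos : 0 < mu
  eta_gt : 2 < eta
  rho_pos : 0 < rho
  sigma2_nonneg : 0 ≤ sigma2
  thSR_pos : 0 < thSR
  thTx_pos : 0 < thTx
  a_nonneg : 0 ≤ a
  a_le : a ≤ 1
  nZ_pos : 0 < nZ
  q_pos : 0 < q
  N_pos : 0 < N

/-! ### Success probabilities -/

/-- Gaussian hypergeometric function `₂F₁(α, β; γ; z)` through Euler's integral, valid for
`0 < β < γ` and `z < 1` (the power series diverges for `z < -1`). -/
def hyp2F1 (α β γ z : ℝ) : ℝ :=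
  Real.Gamma γ / (Real.Gamma β * Real.Gamma (γ - β)) *
    ∫ t in (0 : ℝ)..1, t ^ (β - 1) * (1 - t) ^ (γ - β - 1) * (1 - z * t) ^ (-α)

/-- Constant of the approximate law of the area of a planar Poisson-Voronoi cell. -/
def cVor : ℝ := 3.575

/-- Probability that `n` points of a process of intensity `m` lie in a cell of the base-station
process of intensity `lam` (gamma approximation of the cell area). -/
def cellPMF (lam m : ℝ) (n : ℕ) : ℝ :=
  Real.Gamma (n + cVor) / (Real.Gamma (n + 1) * Real.Gamma cVor) *
    (m ^ n * (lam * cVor) ^ cVor / (m + lam * cVor) ^ ((n : ℝ) + cVor))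

namespace Network

variable (D : Network)

/-- Intensity of devices per preamble sequence. -/
def muZ : ℝ := D.mu / D.nZ

/-- Laplace transform of the intercell interference of the scheduling requests at
`k * thSR / rho`, when a device is in the request phase with probability `f`. -/
def lapInter (f : ℝ) (k : ℕ) : ℝ :=
  Real.exp (-2 * k * D.thSR * (f * D.muZ / D.lam) *
    (hyp2F1 1 (1 - 2 / D.eta) (2 - 2 / D.eta) (-(k * D.thSR)) / (D.eta - 2)))

/-- Laplace transform of the intracell interference at `k * thSR / rho` given `n` neighbours;
without neighbours there is no interference and it is `1`. -/
def lapIntra (n k : ℕ) : ℝ :=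
  if n = 0 then 1 else
    ((n : ℝ) + 1) / (1 + k * D.thSR) *
      (1 / n - Real.Gamma n * Real.Gamma (2 + k * D.thSR) / Real.Gamma (2 + n + k * D.thSR))

/-- Request success probability given `n` neighbours on the same sequence. -/
def condRA (f : ℝ) (n : ℕ) : ℝ :=
  (∑ k ∈ Finset.Icc 1 (n + 1), ((n + 1).choose k : ℝ) * (-1) ^ (k + 1) *
    Real.exp (-(k * D.thSR * D.sigma2 / D.rho)) * D.lapInter f k * D.lapIntra n k) / (n + 1)

/-- Request success probability `P_RA`, as a function of the probability `f` of the request phase. -/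
def pRA (f : ℝ) : ℝ := ∑' n : ℕ, cellPMF D.lam (f * D.muZ) n * D.condRA f n

/-- Data success probability `P_Tx`. -/
def pTx : ℝ :=
  Real.exp (-(D.sigma2 * D.thTx / D.rho) -
    2 * D.thTx / (D.eta - 2) * hyp2F1 1 (1 - 2 / D.eta) (2 - 2 / D.eta) (-D.thTx))

/-- Phase vectors: index `0` is the request phase, index `k = 1, …, N` is the `k`-th granted slot. -/
abbrev Vec : Type := Fin (D.N + 1) → ℝ

/-- Square matrices over the phases. -/
abbrev Mat : Type := Matrix (Fin (D.N + 1)) (Fin (D.N + 1)) ℝ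

/-- Probability `P_aval` that fewer than `q` devices of the cell hold a resource block for the next
slot, i.e. are in one of the granted slots `1, …, N - 1`. -/
def pAval (φ : D.Vec) : ℝ :=
  ∑ n ∈ Finset.range D.q,
    cellPMF D.lam (D.mu * ∑ k with k ≠ 0 ∧ k ≠ Fin.last D.N, φ k) n

/-- Phase-occupancy vectors that leave a nonnegative idle probability `1 - ∑ j, φ j`. -/
def IsLoad (φ : D.Vec) : Prop := (∀ j, 0 ≤ φ j) ∧ ∑ j, φ j ≤ 1

/-! ### The queue of a device whose success probabilities are evaluated at `φ` -/

/-- Phase transitions without departure. Addition in `Fin (N + 1)` is cyclic: after the last granted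
slot the device returns to the request phase. -/
def S (φ : D.Vec) : D.Mat := fun i j =>
  if i = 0 then
    if j = 0 then (1 - D.pRA (φ 0)) + D.pRA (φ 0) * (1 - D.pAval φ)
    else if j = 1 then D.pRA (φ 0) * D.pAval φ
    else 0
  else if j = i + 1 then 1 - D.pTx else 0

/-- Phase transitions with departure. -/
def G : D.Mat := fun i j => if i ≠ 0 ∧ j = i + 1 then D.pTx else 0

def A0 (φ : D.Vec) : D.Mat := D.a • D.S φ
def A1 (φ : D.Vec) : D.Mat := D.a • D.G + (1 - D.a) • D.S φ
def A2 : D.Mat := (1 - D.a) • D.G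

/-- Transitions from idle to level one: an arriving packet starts in the request phase. -/
def C : D.Vec := fun j => if j = 0 then D.a else 0

/-- Transitions from level one to idle. -/
def E (φ : D.Vec) : D.Vec := (1 - D.a) • ((1 : D.Vec) - D.S φ *ᵥ 1)

/-- `none` is the idle state, `some (i, j)` means `i + 1` packets in the buffer and phase `j`. -/
abbrev State : Type := Option (ℕ × Fin (D.N + 1))

/-- Transition probabilities of the quasi-birth-death chain. -/
def trans (φ : D.Vec) : D.State → D.State → ℝ
  | none, none => 1 - D.a
  | none, some (l, j) => if l = 0 then D.C j else 0
  | some (l, i), none => if l = 0 then D.E φ i else 0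
  | some (l, i), some (l', j) =>
      if l' = l + 1 then D.A0 φ i j
      else if l' = l then D.A1 φ i j
      else if l = l' + 1 then D.A2 i j
      else 0

/-- `x` is a stationary distribution of the chain with success probabilities evaluated at `φ`. -/
def IsStationary (φ : D.Vec) (x : D.State → ℝ) : Prop :=
  (∀ s, 0 ≤ x s) ∧ HasSum x 1 ∧ ∀ t, HasSum (fun s => x s * D.trans φ s t) (x t)

/-- Spatiotemporal steady state of a generic device: the chain whose success probabilities are
evaluated at `φ` has a stationary distribution with idle probability `x₀` and phase occupancies `φ`. -/
def IsSteadyState (x₀ : ℝ) (φ : D.Vec) : Prop :=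
  ∃ x : D.State → ℝ, D.IsStationary φ x ∧ x none = x₀ ∧
    ∀ j, HasSum (fun i : ℕ => x (some (i, j))) (φ j)

/-- The vector `ν` that the algorithm uses in the stability check. -/
def nu (φ : D.Vec) : D.Vec := fun j =>
  if j = 0 then 1 / (1 + D.N * (D.pRA (φ 0) * D.pAval φ))
  else 1 / (1 + D.N * (D.pRA (φ 0) * D.pAval φ)) * (D.pRA (φ 0) * D.pAval φ)

/-- The stability condition. -/
def Stable (φ : D.Vec) : Prop :=
  D.nu φ ⬝ᵥ (D.a • (D.S φ *ᵥ 1)) < D.nu φ ⬝ᵥ ((1 - D.a) • (D.G *ᵥ 1))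

/-- `R` is the minimal nonnegative solution of `R = A₀ + R A₁ + R² A₂`. -/
def IsRMatrix (φ : D.Vec) (R : D.Mat) : Prop :=
  (∀ i j, 0 ≤ R i j) ∧ R = D.A0 φ + R * D.A1 φ + R ^ 2 * D.A2 ∧
    ∀ R' : D.Mat, (∀ i j, 0 ≤ R' i j) → R' = D.A0 φ + R' * D.A1 φ + R' ^ 2 * D.A2 →
      ∀ i j, R i j ≤ R' i j

/-- The matrix of the boundary equation `x₁ (I - A₁ - R A₂) = x₀ C`. -/
def bdry (φ : D.Vec) (R : D.Mat) : D.Mat := 1 - D.A1 φ - R * D.A2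

/-- Idle probability of the queue, computed from `R`. -/
def idle (φ : D.Vec) (R : D.Mat) : ℝ :=
  (1 + D.C ⬝ᵥ (((1 - R) * D.bdry φ R)⁻¹ *ᵥ 1))⁻¹

/-- Probabilities of the states with one packet, computed from `R`. -/
def level1 (φ : D.Vec) (R : D.Mat) : D.Vec := D.idle φ R • (D.C ᵥ* (D.bdry φ R)⁻¹)

/-- Phase occupancies `x₁ (I - R)⁻¹`, computed from `R`. -/
def occ (φ : D.Vec) (R : D.Mat) : D.Vec := D.level1 φ R ᵥ* (1 - R)⁻¹

/-! ### The algorithms -/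

/-- Iterates of the first algorithm (computation of `R`). -/
def rIter (φ : D.Vec) : ℕ → D.Mat
  | 0 => 0
  | m + 1 => D.A0 φ + rIter φ m * D.A1 φ + rIter φ m ^ 2 * D.A2

/-- The stopping criterion of the first algorithm with tolerance `δ` holds after `m + 1` updates. -/
def RStops (φ : D.Vec) (δ : ℝ) (m : ℕ) : Prop :=
  ∀ i j, |D.rIter φ (m + 1) i j - D.rIter φ m i j| < δ

/-- Output of the first algorithm with tolerance `δ`: the iterate at which the criterion is first
met. -/
def rAlg (φ : D.Vec) (δ : ℝ) : D.Mat := D.rIter φ (sInf {m | D.RStops φ δ m} + 1)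

/-- The update of the second algorithm, with tolerance `δ` in the computation of `R`. -/
def step (δ : ℝ) (φ : D.Vec) : D.Vec := D.occ φ (D.rAlg φ δ)

/-- The stopping criterion of the second algorithm with tolerance `ε`. -/
def Close (ε : ℝ) (φ φ' : D.Vec) : Prop := ∀ j, |φ' j - φ j| < ε

/-- What the second algorithm can return: `unstable`, or a triple `R`, `φ`, `x₀`. -/
inductive Outcome (D : Network) : Type
  | unstable : Outcome D
  | solved (R : D.Mat) (φ : D.Vec) (x₀ : ℝ) : Outcome D

/-- `Returns ε δ φ out`: the second algorithm, with tolerance `ε` for `φ` and `δ` for `R`, run from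
the current vector `φ`, terminates and returns `out`. -/
inductive Returns (D : Network) (ε δ : ℝ) : D.Vec → Outcome D → Prop
  | unstable (φ : D.Vec) (h : ¬ D.Stable φ) : Returns D ε δ φ Outcome.unstable
  | halt (φ : D.Vec) (h : D.Stable φ) (hc : D.Close ε φ (D.step δ φ)) :
      Returns D ε δ φ
        (Outcome.solved (D.rAlg φ δ) (D.step δ φ) (1 - ∑ j, D.step δ φ j))
  | next (φ : D.Vec) (out : Outcome D) (h : D.Stable φ) (hc : ¬ D.Close ε φ (D.step δ φ))
      (hr : Returns D ε δ (D.step δ φ) out) : Returns D ε δ φ out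

/-- One pass of the second algorithm in exact arithmetic: the stability check succeeds and the new
vector is computed from the exact matrix `R`. -/
def ExactStep (φ φ' : D.Vec) : Prop :=
  D.Stable φ ∧ ∃ R : D.Mat, D.IsRMatrix φ R ∧ φ' = D.occ φ R

end Network

end SCUL

end

/-!
The proof is elementary and rests on two explicit facts about the model.

*Probabilities.* `condRA` is an alternating binomial sum of `c k = e ^ (-ψ k) * lapIntra n k`. After
Euler's integral is simplified, `ψ` has completely monotone increments (`complMono_lapInter`), and
partial fractions write the intracell factor as a positive combination of products of terms
`1 / (a + k θ)` (`lapIntra_succ`). Hence `c` is completely monotone with `c 0 = 1`, that is,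
`c k = E[Z ^ k]` for some `Z` in `[0, 1]`, and the sum is `E[1 - (1 - Z) ^ (n + 1)]`; this is
`ComplMono.alternating_sum_mem`, proved with finite differences alone. The negative binomial series
dominates the series of `pRA` uniformly, so `pRA` and `pAval` lie in `(0, 1]` and are continuous on
loads.

*The chain.* Put `r = pRA * pAval` (`grant`). The check says `a (1 + N r) < N r p`
(`IsLoad.stable_iff`). A stationary distribution has departure rate `p V = a`, and the mass `V` of the
granted slots is at most `N r` times that of the request phase; since the idle state carries mass, the
check follows (`IsStationary.stable`). Conversely, under the check there are `ζ, θ < 1` and an explicit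
positive row vector `y` with `y (A₀ + ζ A₁ + ζ² A₂) ≤ θ ζ y` (`IsLoad.exists_certificate`). By
induction all iterates `X` of the first algorithm satisfy `y X ≤ ζ y`, and so does their limit, the
minimal solution. This makes `I - X` and `I - A₁ - X A₂` invertible with nonnegative inverses, and the
matrix-geometric distribution stationary. Uniqueness, both of the solution of the matrix equation below
the certificate and of the stationary distribution, comes from `eq_zero_of_backward_recursion`: as
`A₀ e = R A₂ e`, the matrix `(I - A₁ - R A₂)⁻¹ A₂` is stochastic.

*Limits.* A strict certificate persists under small changes of the load, so compactness and uniqueness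
show that approximate solutions of the matrix equation converge to the rate matrix at a stable limit
(`tendsto_rateMatrix`). At an unstable limit, the certificate `y = ν`, `ζ = θ = 1` still bounds the
approximate solutions; if the idle probability stayed positive, their limit would produce a stationary
distribution (`stable_of_tendsto`), which is impossible. The statements on the algorithms follow.
-/

namespace SCUL

/-! ### Completely monotone sequences -/

/-- `c` is completely monotone on `{0, …, K}`: the alternating finite differences
`(-1) ^ n * Δ ^ n c m` that involve only the values `c 0, …, c K` are nonnegative. -/
def ComplMono (K : ℕ) (c : ℕ → ℝ) : Prop :=
  ∀ n m : ℕ, n + m ≤ K → 0 ≤ (-1) ^ n * (fwdDiff 1)^[n] c m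

namespace ComplMono

lemma fwdDiff_iter_sub_succ (c : ℕ → ℝ) (n m : ℕ) :
    (fwdDiff 1)^[n] (fun k => c k - c (k + 1)) m = -(fwdDiff 1)^[n + 1] c m := by
  have h : (fun k => c k - c (k + 1)) = (-1 : ℝ) • fwdDiff 1 c := by
    funext k; simp [fwdDiff]
  rw [h, fwdDiff_iter_const_smul, Function.iterate_succ_apply]
  simp

lemma nonneg {K : ℕ} {c : ℕ → ℝ} (h : ComplMono K c) {m : ℕ} (hm : m ≤ K) : 0 ≤ c m := by
  simpa using h 0 m (by simpa using hm)

lemma sub_succ {K : ℕ} {c : ℕ → ℝ} (h : ComplMono (K + 1) c) :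
    ComplMono K (fun k => c k - c (k + 1)) := by
  intro n m hnm
  rw [fwdDiff_iter_sub_succ]
  have := h (n + 1) m (by omega)
  rw [pow_succ] at this
  linarith

lemma of_sub_succ {K : ℕ} {c : ℕ → ℝ} (h0 : ∀ m ≤ K + 1, 0 ≤ c m)
    (h : ComplMono K (fun k => c k - c (k + 1))) : ComplMono (K + 1) c := by
  intro n m hnm
  cases n with
  | zero => simpa using h0 m (by omega)
  | succ n =>
    have := h n m (by omega)
    rw [fwdDiff_iter_sub_succ] at this
    rw [pow_succ]
    linarith

lemma mono {K : ℕ} {c : ℕ → ℝ} (h : ComplMono (K + 1) c) : ComplMono K c :=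
  fun n m hnm => h n m (by omega)

lemma shift {K : ℕ} {c : ℕ → ℝ} (h : ComplMono (K + 1) c) : ComplMono K (fun k => c (k + 1)) := by
  intro n m hnm
  have := fwdDiff_iter_comp_add (1 : ℕ) c 1 n m
  rw [this]
  exact h n (m + 1) (by omega)

lemma congr {K : ℕ} {c d : ℕ → ℝ} (h : ComplMono K c) (e : ∀ k, c k = d k) : ComplMono K d := by
  rwa [← funext e]

lemma zero_iff {c : ℕ → ℝ} : ComplMono 0 c ↔ 0 ≤ c 0 := by
  constructor
  · exact fun h => h.nonneg le_rfl
  · intro h n m hnm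
    obtain ⟨rfl, rfl⟩ : n = 0 ∧ m = 0 := by omega
    simpa using h

lemma add {K : ℕ} {c d : ℕ → ℝ} (hc : ComplMono K c) (hd : ComplMono K d) :
    ComplMono K (fun k => c k + d k) := by
  intro n m hnm
  have h : (fun k => c k + d k) = c + d := rfl
  rw [h, fwdDiff_iter_add, Pi.add_apply, mul_add]
  exact add_nonneg (hc n m hnm) (hd n m hnm)

lemma const_mul {K : ℕ} {c : ℕ → ℝ} (hc : ComplMono K c) {r : ℝ} (hr : 0 ≤ r) :
    ComplMono K (fun k => r * c k) := by
  intro n m hnm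
  have h : (fun k => r * c k) = r • c := rfl
  rw [h, fwdDiff_iter_const_smul, Pi.smul_apply, smul_eq_mul, mul_left_comm]
  exact mul_nonneg hr (hc n m hnm)

lemma const (K : ℕ) {r : ℝ} (hr : 0 ≤ r) : ComplMono K (fun _ => r) := by
  induction K generalizing r with
  | zero => exact zero_iff.2 hr
  | succ K ih => exact of_sub_succ (fun _ _ => hr) ((ih le_rfl).congr (by simp))

lemma sum {ι : Type*} (s : Finset ι) {K : ℕ} {c : ι → ℕ → ℝ} (h : ∀ i ∈ s, ComplMono K (c i)) :
    ComplMono K (fun k => ∑ i ∈ s, c i k) := by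
  classical
  induction s using Finset.induction_on with
  | empty => exact (const K le_rfl).congr (by simp)
  | insert i s hi ih =>
    refine ((h i (by simp)).add (ih fun j hj => h j (by simp [hj]))).congr fun k => ?_
    rw [Finset.sum_insert hi]

lemma mul {K : ℕ} {c d : ℕ → ℝ} (hc : ComplMono K c) (hd : ComplMono K d) :
    ComplMono K (fun k => c k * d k) := by
  induction K generalizing c d with
  | zero => exact zero_iff.2 (mul_nonneg (zero_iff.1 hc) (zero_iff.1 hd))
  | succ K ih =>
    refine of_sub_succ (fun m hm => mul_nonneg (hc.nonneg hm) (hd.nonneg hm)) ?_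
    refine ((ih hc.sub_succ hd.mono).add (ih hc.shift hd.sub_succ)).congr fun k => ?_
    ring

lemma pow {K : ℕ} {c : ℕ → ℝ} (hc : ComplMono K c) (j : ℕ) : ComplMono K (fun k => c k ^ j) := by
  induction j with
  | zero => exact (const K zero_le_one).congr (by simp)
  | succ j ih => exact (ih.mul hc).congr fun k => (pow_succ _ _).symm

lemma prod {ι : Type*} (s : Finset ι) {K : ℕ} {c : ι → ℕ → ℝ} (h : ∀ i ∈ s, ComplMono K (c i)) :
    ComplMono K (fun k => ∏ i ∈ s, c i k) := by
  classical
  induction s using Finset.induction_on with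
  | empty => exact (const K zero_le_one).congr (by simp)
  | insert i s hi ih =>
    refine ((h i (by simp)).mul (ih fun j hj => h j (by simp [hj]))).congr fun k => ?_
    rw [Finset.prod_insert hi]

lemma tendsto_fwdDiff {c : ℕ → ℕ → ℝ} {d : ℕ → ℝ}
    (hd : ∀ k, Tendsto (fun i => c i k) atTop (𝓝 (d k))) (n m : ℕ) :
    Tendsto (fun i => (fwdDiff 1)^[n] (c i) m) atTop (𝓝 ((fwdDiff 1)^[n] d m)) := by
  simp only [fwdDiff_iter_eq_sum_shift, zsmul_eq_mul]
  exact tendsto_finsetSum _ fun k _ => (hd _).const_mul _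

lemma of_tendsto {K : ℕ} {c : ℕ → ℕ → ℝ} {d : ℕ → ℝ} (h : ∀ i, ComplMono K (c i))
    (hd : ∀ k, Tendsto (fun i => c i k) atTop (𝓝 (d k))) : ComplMono K d := fun n m hnm =>
  ge_of_tendsto' ((tendsto_fwdDiff hd n m).const_mul _) fun i => h i n m hnm

lemma exp {K : ℕ} {c : ℕ → ℝ} (hc : ComplMono K c) : ComplMono K (fun k => Real.exp (c k)) := by
  refine of_tendsto (c := fun i k => ∑ j ∈ Finset.range i, c k ^ j / (j.factorial : ℝ)) ?_ ?_
  · intro i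
    refine sum _ fun j _ => ?_
    refine ((hc.pow j).const_mul (r := ((j.factorial : ℝ))⁻¹) (by positivity)).congr fun k => ?_
    ring
  · intro k
    rw [Real.exp_eq_exp_ℝ]
    exact (NormedSpace.expSeries_div_hasSum_exp (c k)).tendsto_sum_nat

/-- The exponential of minus a sequence with completely monotone increments (a discrete Bernstein
function) is completely monotone, because `e ^ (-ψ) = e ^ (-ψ K) * e ^ (ψ K - ψ)`. -/
lemma exp_neg {K : ℕ} {ψ : ℕ → ℝ} (h : ∀ K, ComplMono K (fun k => ψ (k + 1) - ψ k)) :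
    ComplMono K (fun k => Real.exp (-ψ k)) := by
  have hm : Monotone ψ := monotone_nat_of_le_succ fun n => by
    have := (h n).nonneg le_rfl
    linarith
  have hB : ComplMono K (fun k => ψ K - ψ k) := by
    cases K with
    | zero => exact zero_iff.2 (by simp)
    | succ K =>
      refine of_sub_succ (fun m hK => sub_nonneg.2 (hm hK)) ((h K).congr fun k => ?_)
      ring
  refine (hB.exp.const_mul (Real.exp_pos (-ψ K)).le).congr fun k => ?_
  rw [← Real.exp_add]
  congr 1
  ring

lemma inv_linear {K : ℕ} {a t : ℝ} (ha : 0 < a) (ht : 0 ≤ t) :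
    ComplMono K (fun k => (a + k * t)⁻¹) := by
  induction K generalizing a with
  | zero => exact zero_iff.2 (by simpa using ha.le)
  | succ K ih =>
    refine of_sub_succ (fun m _ => by positivity) ?_
    refine (((ih ha).mul (ih (a := a + t) (by positivity))).const_mul ht).congr fun k => ?_
    have h1 : a + k * t ≠ 0 := by positivity
    have h2 : a + t + k * t ≠ 0 := by positivity
    have h3 : a + ((k + 1 : ℕ) : ℝ) * t ≠ 0 := by positivity
    field_simp
    push_cast
    ring

lemma integral {K : ℕ} {g : ℕ → ℝ → ℝ} (hg : ∀ t ∈ Set.Ioc (0 : ℝ) 1, ComplMono K (fun k => g k t))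
    (hi : ∀ k, IntervalIntegrable (g k) MeasureTheory.volume 0 1) :
    ComplMono K (fun k => ∫ t in (0 : ℝ)..1, g k t) := by
  intro n m hnm
  have h1 : (fwdDiff 1)^[n] (fun k => ∫ t in (0 : ℝ)..1, g k t) m
      = ∫ t in (0 : ℝ)..1, (fwdDiff 1)^[n] (fun k => g k t) m := by
    simp only [fwdDiff_iter_eq_sum_shift, zsmul_eq_mul]
    rw [intervalIntegral.integral_finsetSum fun k _ => (hi _).const_mul _]
    simp
  rw [h1, ← intervalIntegral.integral_const_mul, intervalIntegral.integral_of_le zero_le_one]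
  exact MeasureTheory.setIntegral_nonneg measurableSet_Ioc fun t ht => hg t ht n m hnm

/-- Inclusion-exclusion for a completely monotone sequence: if `c k = E[Z ^ k]`, the sum is
`1 - E[(1 - Z) ^ (n + 1)]`. -/
lemma alternating_sum_mem {n : ℕ} {c : ℕ → ℝ} (hc : ComplMono (n + 1) c) (h0 : c 0 = 1) :
    (∑ k ∈ Finset.Icc 1 (n + 1), ((n + 1).choose k : ℝ) * (-1) ^ (k + 1) * c k)
      ∈ Set.Icc (c 1) 1 := by
  have hsum : ∀ j : ℕ, (-1) ^ j * (fwdDiff 1)^[j] c 0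
      = ∑ k ∈ Finset.range (j + 1), (j.choose k : ℝ) * (-1) ^ k * c k := by
    intro j
    rw [fwdDiff_iter_eq_sum_shift, Finset.mul_sum]
    refine Finset.sum_congr rfl fun k hk => ?_
    have hk' : k ≤ j := by simpa [Nat.lt_succ_iff] using hk
    obtain ⟨i, rfl⟩ := Nat.exists_eq_add_of_le hk'
    have hii : ((-1 : ℝ) ^ i) * (-1) ^ i = 1 := by rw [← mul_pow]; simp
    simp only [zsmul_eq_mul, add_tsub_cancel_left, smul_eq_mul, mul_one, zero_add]
    push_cast
    rw [pow_add]
    linear_combination ((k + i).choose k : ℝ) * (-1) ^ k * c k * hii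
  have hE : (∑ k ∈ Finset.Icc 1 (n + 1), ((n + 1).choose k : ℝ) * (-1) ^ (k + 1) * c k)
      = 1 - (-1) ^ (n + 1) * (fwdDiff 1)^[n + 1] c 0 := by
    rw [hsum, Finset.sum_range_succ', Finset.range_eq_Ico, Finset.sum_Ico_add' (fun k =>
      ((n + 1).choose k : ℝ) * (-1) ^ k * c k) 0 (n + 1) 1]
    simp only [zero_add, Nat.choose_zero_right, Nat.cast_one, pow_zero, h0, mul_one]
    rw [sub_add_cancel_right, ← Finset.sum_neg_distrib]
    refine Finset.sum_congr (by ext; simp) fun k _ => by ring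
  rw [hE]
  constructor
  · -- the differences at `0` decrease, and the first step already loses `c 1`
    have key : ∀ j : ℕ, j + 1 ≤ n + 1 → c 1 ≤ 1 - (-1) ^ (j + 1) * (fwdDiff 1)^[j + 1] c 0 := by
      intro j
      induction j with
      | zero => intro _; simp [fwdDiff, h0]
      | succ j ih =>
        intro hj
        have h1 := ih (by omega)
        have h2 := hc (j + 1) 1 (by omega)
        rw [Function.iterate_succ_apply' _ (j + 1), fwdDiff]
        rw [pow_succ (-1 : ℝ) (j + 1)]
        simp only [zero_add]
        linarith
    exact key n le_rfl
  · have := hc (n + 1) 0 (by omega)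
    linarith

end ComplMono

/-! ### The cell population: a negative binomial law -/

lemma Gamma_add_natCast {c : ℝ} (hc : 0 < c) (n : ℕ) :
    Real.Gamma (n + c) = (ascPochhammer ℝ n).eval c * Real.Gamma c := by
  induction n with
  | zero => simp
  | succ n ih =>
    have h : ((n + 1 : ℕ) : ℝ) + c = (n + c) + 1 := by push_cast; ring
    rw [h, Real.Gamma_add_one (by positivity), ih, ascPochhammer_succ_eval]
    ring

lemma Gamma_div_eq_choose {c : ℝ} (hc : 0 < c) (n : ℕ) :
    Real.Gamma (n + c) / (Real.Gamma (n + 1) * Real.Gamma c) = Ring.choose (c + n - 1) n := by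
  have h1 : Ring.choose (c + n - 1) n = Ring.multichoose c n := by
    rw [Ring.choose]; congr 1; ring
  have h2 := Ring.factorial_nsmul_multichoose_eq_ascPochhammer c n
  rw [Polynomial.ascPochhammer_smeval_eq_eval, nsmul_eq_mul] at h2
  have h3 : Real.Gamma c ≠ 0 := (Real.Gamma_pos_of_pos hc).ne'
  have h4 : (n.factorial : ℝ) ≠ 0 := by positivity
  rw [Real.Gamma_nat_eq_factorial, Gamma_add_natCast hc, h1, ← h2]
  field_simp

lemma hasSum_choose_mul_pow (c : ℝ) {x : ℝ} (h0 : 0 ≤ x) (h1 : x < 1) :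
    HasSum (fun n : ℕ => Ring.choose (c + n - 1) n * x ^ n) (1 / (1 - x) ^ c) := by
  have h := (Real.one_div_one_sub_rpow_hasFPowerSeriesOnBall_zero c).hasSum (y := x)
    (by simp [Metric.mem_eball, edist_dist, abs_of_nonneg h0, h1])
  simpa [FormalMultilinearSeries.ofScalars_apply_eq, mul_comm] using h

lemma cVor_pos : 0 < cVor := by norm_num [cVor]

lemma choose_cVor_pos (n : ℕ) : 0 < Ring.choose (cVor + n - 1) n := by
  rw [← Gamma_div_eq_choose cVor_pos]
  have h1 := Real.Gamma_pos_of_pos cVor_pos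
  have h2 : 0 < Real.Gamma (n + cVor) :=
    Real.Gamma_pos_of_pos (add_pos_of_nonneg_of_pos n.cast_nonneg cVor_pos)
  have h3 : 0 < Real.Gamma ((n : ℝ) + 1) := Real.Gamma_pos_of_pos (by positivity)
  positivity

lemma cellPMF_eq {lam m : ℝ} (hl : 0 < lam) (hm : 0 ≤ m) (n : ℕ) :
    cellPMF lam m n = Ring.choose (cVor + n - 1) n * (m / (m + lam * cVor)) ^ n *
      (1 - m / (m + lam * cVor)) ^ cVor := by
  have hc := cVor_pos
  have hlc : 0 < lam * cVor := mul_pos hl hc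
  have hs : 0 < m + lam * cVor := by positivity
  have h1 : 1 - m / (m + lam * cVor) = lam * cVor / (m + lam * cVor) := by field_simp; ring
  rw [cellPMF, Gamma_div_eq_choose hc, h1, Real.div_rpow hlc.le hs.le, Real.rpow_add hs,
    Real.rpow_natCast, div_pow]
  ring

lemma ratio_mem {lam m : ℝ} (hl : 0 < lam) (hm : 0 ≤ m) :
    0 ≤ m / (m + lam * cVor) ∧ m / (m + lam * cVor) < 1 := by
  have hlc : 0 < lam * cVor := mul_pos hl cVor_pos
  exact ⟨by positivity, (div_lt_one (by positivity)).2 (by linarith)⟩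

lemma hasSum_cellPMF {lam m : ℝ} (hl : 0 < lam) (hm : 0 ≤ m) : HasSum (cellPMF lam m) 1 := by
  obtain ⟨h0, h1⟩ := ratio_mem hl hm
  have h := (hasSum_choose_mul_pow cVor h0 h1).mul_right ((1 - m / (m + lam * cVor)) ^ cVor)
  rw [one_div, inv_mul_cancel₀ (Real.rpow_pos_of_pos (by linarith) _).ne'] at h
  rwa [funext (cellPMF_eq hl hm)]

lemma cellPMF_nonneg {lam m : ℝ} (hl : 0 < lam) (hm : 0 ≤ m) (n : ℕ) : 0 ≤ cellPMF lam m n := by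
  obtain ⟨h0, h1⟩ := ratio_mem hl hm
  rw [cellPMF_eq hl hm]
  have := choose_cVor_pos n
  have h2 : 0 ≤ 1 - m / (m + lam * cVor) := by linarith
  positivity

lemma cellPMF_zero_pos {lam m : ℝ} (hl : 0 < lam) (hm : 0 ≤ m) : 0 < cellPMF lam m 0 := by
  obtain ⟨h0, h1⟩ := ratio_mem hl hm
  rw [cellPMF_eq hl hm, pow_zero, mul_one]
  exact mul_pos (choose_cVor_pos 0) (Real.rpow_pos_of_pos (by linarith) _)

lemma continuousOn_cellPMF {lam : ℝ} (hl : 0 < lam) (n : ℕ) :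
    ContinuousOn (fun m => cellPMF lam m n) (Set.Ici 0) := by
  have hlc : 0 < lam * cVor := mul_pos hl cVor_pos
  unfold cellPMF
  refine continuousOn_const.mul (ContinuousOn.div (by fun_prop) ?_ ?_)
  · refine ContinuousOn.rpow_const (by fun_prop) fun m hm => Or.inl ?_
    have : (0 : ℝ) ≤ m := hm
    positivity
  · intro m hm
    have : (0 : ℝ) ≤ m := hm
    exact (Real.rpow_pos_of_pos (by positivity) _).ne'

lemma cellPMF_le {lam m m' : ℝ} (hl : 0 < lam) (hm : 0 ≤ m) (hmm : m ≤ m') (n : ℕ) :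
    cellPMF lam m n ≤ Ring.choose (cVor + n - 1) n * (m' / (m' + lam * cVor)) ^ n := by
  obtain ⟨h0, h1⟩ := ratio_mem hl hm
  have hlc : 0 < lam * cVor := mul_pos hl cVor_pos
  have hle : m / (m + lam * cVor) ≤ m' / (m' + lam * cVor) := by
    rw [div_le_div_iff₀ (by positivity) (by linarith)]
    nlinarith
  have hch := choose_cVor_pos n
  rw [cellPMF_eq hl hm]
  calc _ ≤ Ring.choose (cVor + n - 1) n * (m / (m + lam * cVor)) ^ n * 1 := by
        gcongr
        exact Real.rpow_le_one (by linarith) (by linarith) cVor_pos.le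
    _ ≤ _ := by
        rw [mul_one]
        gcongr

/-! ### The success probabilities -/

/-- Euler's integral with `γ - β = 1` and first parameter `1`. -/
lemma hyp2F1_one_eq {b s : ℝ} (hb : 0 < b) :
    hyp2F1 1 b (b + 1) (-s) = b * ∫ t in (0 : ℝ)..1, t ^ (b - 1) * (1 + s * t)⁻¹ := by
  have hg : Real.Gamma b ≠ 0 := (Real.Gamma_pos_of_pos hb).ne'
  rw [hyp2F1, Real.Gamma_add_one hb.ne', add_sub_cancel_left, Real.Gamma_one, mul_one,
    mul_div_cancel_right₀ _ hg]
  congr 1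
  refine intervalIntegral.integral_congr fun t _ => ?_
  simp [Real.rpow_neg_one]

lemma intervalIntegrable_rpow_mul {b : ℝ} (hb : 0 < b) {h : ℝ → ℝ}
    (hh : ContinuousOn h (Set.Icc 0 1)) :
    IntervalIntegrable (fun t => t ^ (b - 1) * h t) MeasureTheory.volume 0 1 :=
  (intervalIntegral.intervalIntegrable_rpow' (by linarith)).mul_continuousOn
    (by rwa [Set.uIcc_of_le zero_le_one])

lemma continuousOn_inv_one_add {s : ℝ} (hs : 0 ≤ s) :
    ContinuousOn (fun t : ℝ => (1 + s * t)⁻¹) (Set.Icc 0 1) := by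
  refine ContinuousOn.inv₀ (by fun_prop) fun t ht => ?_
  have := mul_nonneg hs ht.1
  positivity

/-- `k * ∫ t ^ (b - 1) / (1 + k s t)` is a discrete Bernstein function: its increments are mixtures
of products of two completely monotone sequences. -/
lemma complMono_integral_succ_sub {b s : ℝ} (hb : 0 < b) (hs : 0 ≤ s) (K : ℕ) :
    ComplMono K (fun k =>
      ((k + 1 : ℕ) : ℝ) * s * (∫ t in (0 : ℝ)..1, t ^ (b - 1) * (1 + ((k + 1 : ℕ) : ℝ) * s * t)⁻¹) -
      (k : ℝ) * s * ∫ t in (0 : ℝ)..1, t ^ (b - 1) * (1 + (k : ℝ) * s * t)⁻¹) := by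
  have hks : ∀ k : ℕ, 0 ≤ (k : ℝ) * s := fun k => by positivity
  have hint := fun k : ℕ => intervalIntegrable_rpow_mul hb (continuousOn_inv_one_add (hks k))
  refine (ComplMono.integral (g := fun k t => t ^ (b - 1) *
    (s * ((1 + (k : ℝ) * s * t)⁻¹ * (1 + ((k + 1 : ℕ) : ℝ) * s * t)⁻¹))) ?_ ?_).congr ?_
  · intro t ht
    refine ComplMono.const_mul (ComplMono.const_mul (ComplMono.mul ?_ ?_) hs)
      (Real.rpow_nonneg ht.1.le _)
    · exact (ComplMono.inv_linear (t := s * t) one_pos (mul_nonneg hs ht.1.le)).congr fun k => by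
        rw [mul_assoc]
    · refine (ComplMono.inv_linear (a := 1 + s * t) (t := s * t) ?_ (mul_nonneg hs ht.1.le)).congr
        fun k => ?_
      · have := mul_nonneg hs ht.1.le
        positivity
      · push_cast
        ring
  · intro k
    exact intervalIntegrable_rpow_mul hb (continuousOn_const.mul
      ((continuousOn_inv_one_add (hks k)).mul (continuousOn_inv_one_add (hks (k + 1)))))
  · intro k
    rw [← intervalIntegral.integral_const_mul, ← intervalIntegral.integral_const_mul,
      ← intervalIntegral.integral_sub ((hint (k + 1)).const_mul _) ((hint k).const_mul _)]
    refine intervalIntegral.integral_congr fun t ht => ?_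
    rw [Set.uIcc_of_le zero_le_one] at ht
    have h1 : 1 + (k : ℝ) * s * t ≠ 0 := by have := mul_nonneg (hks k) ht.1; positivity
    have h2 : 1 + ((k + 1 : ℕ) : ℝ) * s * t ≠ 0 := by
      have := mul_nonneg (hks (k + 1)) ht.1; positivity
    have h3 : ((k + 1 : ℕ) : ℝ) * (1 + (k : ℝ) * s * t) - k * (1 + ((k + 1 : ℕ) : ℝ) * s * t) = 1 := by
      push_cast; ring
    generalize 1 + (k : ℝ) * s * t = u at *
    generalize 1 + ((k + 1 : ℕ) : ℝ) * s * t = v at *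
    field_simp
    linear_combination -h3 * (t ^ (b - 1) * s)

namespace Network

variable (D : Network)

lemma muZ_pos : 0 < D.muZ := div_pos D.mu_pos (Nat.cast_pos.2 D.nZ_pos)

lemma beta_pos : 0 < 1 - 2 / D.eta := by
  have := D.eta_gt
  rw [sub_pos, div_lt_one (by linarith)]
  exact this

lemma hyp2F1_eq (s : ℝ) : hyp2F1 1 (1 - 2 / D.eta) (2 - 2 / D.eta) (-s) =
    (1 - 2 / D.eta) * ∫ t in (0 : ℝ)..1, t ^ (1 - 2 / D.eta - 1) * (1 + s * t)⁻¹ := by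
  rw [← hyp2F1_one_eq D.beta_pos]
  congr 1
  ring

lemma complMono_lapInter {f : ℝ} (hf : 0 ≤ f) (K : ℕ) : ComplMono K (D.lapInter f) := by
  have hb := D.beta_pos
  have hth := D.thSR_pos
  have hmu := D.muZ_pos
  have hlam := D.lam_pos
  have heta : 0 < D.eta - 2 := by linarith [D.eta_gt]
  refine (ComplMono.exp_neg (K := K) (ψ := fun k : ℕ =>
    2 * (f * D.muZ / D.lam) * (1 - 2 / D.eta) / (D.eta - 2) * (k * D.thSR *
      ∫ t in (0 : ℝ)..1, t ^ (1 - 2 / D.eta - 1) * (1 + k * D.thSR * t)⁻¹)) fun K => ?_).congr ?_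
  · refine ((complMono_integral_succ_sub hb hth.le K).const_mul
      (r := 2 * (f * D.muZ / D.lam) * (1 - 2 / D.eta) / (D.eta - 2)) (by positivity)).congr
      fun k => ?_
    rw [mul_sub]
  · intro k
    rw [lapInter, D.hyp2F1_eq]
    congr 1
    ring

lemma complMono_noise (K : ℕ) :
    ComplMono K (fun k : ℕ => Real.exp (-(k * D.thSR * D.sigma2 / D.rho))) := by
  have h : 0 ≤ D.thSR * D.sigma2 / D.rho :=
    div_nonneg (mul_nonneg D.thSR_pos.le D.sigma2_nonneg) D.rho_pos.le
  refine ComplMono.exp_neg (ψ := fun k : ℕ => k * D.thSR * D.sigma2 / D.rho) fun K =>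
    (ComplMono.const K h).congr fun k => ?_
  push_cast
  ring

/-- Partial fractions for the intracell transform: `u ^ s (1 - (1 - u) ^ n)` is expanded in powers of
`1 - u` before it is integrated over `[0, 1]`. -/
lemma one_sub_factorial_div_prod {s : ℝ} (hs : 0 ≤ s) (n : ℕ) :
    (1 - n.factorial * ∏ i ∈ Finset.range n, (2 + i + s)⁻¹) / (1 + s) =
      ∑ j ∈ Finset.range n, j.factorial * ∏ i ∈ Finset.range (j + 1), (2 + i + s : ℝ)⁻¹ := by
  induction n with
  | zero => simp
  | succ n ih =>
    rw [Finset.sum_range_succ, ← ih, Finset.prod_range_succ, Nat.factorial_succ]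
    have h1 : 1 + s ≠ 0 := by positivity
    have h2 : 2 + (n : ℝ) + s ≠ 0 := by positivity
    generalize ∏ i ∈ Finset.range n, (2 + (i : ℝ) + s)⁻¹ = P
    field_simp
    push_cast
    ring

lemma Gamma_eq_prod {s : ℝ} (hs : 0 ≤ s) (n : ℕ) :
    Real.Gamma (2 + s) / Real.Gamma (2 + n + s) = ∏ i ∈ Finset.range n, (2 + i + s : ℝ)⁻¹ := by
  induction n with
  | zero => simp [(Real.Gamma_pos_of_pos (show 0 < 2 + s by positivity)).ne']
  | succ n ih =>
    have h : (2 : ℝ) + ((n + 1 : ℕ) : ℝ) + s = (2 + n + s) + 1 := by push_cast; ring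
    rw [Finset.prod_range_succ, ← ih, h, Real.Gamma_add_one (by positivity), mul_comm (2 + (n : ℝ) + s),
      ← div_div, div_eq_mul_inv]

lemma lapIntra_succ (n k : ℕ) : D.lapIntra (n + 1) k = ((n + 1 : ℝ) + 1) / (n + 1) *
    ∑ j ∈ Finset.range (n + 1), j.factorial *
      ∏ i ∈ Finset.range (j + 1), (2 + i + k * D.thSR : ℝ)⁻¹ := by
  have hs : 0 ≤ k * D.thSR := mul_nonneg k.cast_nonneg D.thSR_pos.le
  rw [← one_sub_factorial_div_prod hs, ← Gamma_eq_prod hs, lapIntra, if_neg (by omega),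
    Nat.factorial_succ]
  have h1 : 1 + k * D.thSR ≠ 0 := by positivity
  have h2 : Real.Gamma (2 + ((n + 1 : ℕ) : ℝ) + k * D.thSR) ≠ 0 :=
    (Real.Gamma_pos_of_pos (by positivity)).ne'
  have h3 : Real.Gamma ((n + 1 : ℕ) : ℝ) = n.factorial := by
    push_cast; exact Real.Gamma_nat_eq_factorial n
  rw [h3]
  push_cast at h2 ⊢
  field_simp

lemma complMono_lapIntra (n K : ℕ) : ComplMono K (D.lapIntra n) := by
  cases n with
  | zero => exact (ComplMono.const K zero_le_one).congr (by simp [lapIntra])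
  | succ n =>
    refine ((ComplMono.sum (Finset.range (n + 1)) fun j _ => ((ComplMono.prod
      (c := fun i k => ((2 + i : ℝ) + k * D.thSR)⁻¹) (Finset.range (j + 1)) fun i _ =>
      ComplMono.inv_linear (by positivity) D.thSR_pos.le).const_mul
        (r := (j.factorial : ℝ)) (by positivity))).const_mul
      (r := ((n + 1 : ℝ) + 1) / (n + 1)) (by positivity)).congr fun k => ?_
    rw [lapIntra_succ]

lemma lapIntra_pos (n k : ℕ) : 0 < D.lapIntra n k := by
  cases n with
  | zero => simp [lapIntra]
  | succ n =>
    rw [lapIntra_succ]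
    have := D.thSR_pos
    refine mul_pos (by positivity) (Finset.sum_pos (fun j _ => ?_) (by simp))
    exact mul_pos (by positivity) (Finset.prod_pos fun i _ => by positivity)

lemma lapIntra_zero (n : ℕ) : D.lapIntra n 0 = 1 := by
  cases n with
  | zero => simp [lapIntra]
  | succ n =>
    have h := Real.Gamma_nat_eq_factorial n
    have h' : Real.Gamma (2 + ((n + 1 : ℕ) : ℝ)) = (n + 2).factorial := by
      rw [← Real.Gamma_nat_eq_factorial]; push_cast; congr 1; ring
    rw [lapIntra, if_neg (by omega)]
    simp only [Nat.cast_zero, zero_mul, add_zero, h', Real.Gamma_two]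
    push_cast
    rw [h, Nat.factorial_succ, Nat.factorial_succ]
    push_cast
    field_simp
    ring

/-- The conditional success probability is `E[1 - (1 - Z) ^ (n + 1)] / (n + 1)` for a random variable
`Z` with values in `[0, 1]`, whence the bounds. -/
lemma condRA_mem {f : ℝ} (hf : 0 ≤ f) (n : ℕ) : D.condRA f n ∈ Set.Ioc (0 : ℝ) 1 := by
  have hc : ComplMono (n + 1) (fun k : ℕ =>
      Real.exp (-(k * D.thSR * D.sigma2 / D.rho)) * D.lapInter f k * D.lapIntra n k) :=
    ((D.complMono_noise _).mul (D.complMono_lapInter hf _)).mul (D.complMono_lapIntra n _)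
  have h := hc.alternating_sum_mem (by simp [lapInter, lapIntra_zero])
  simp only [← mul_assoc] at h
  have h1 : 0 < Real.exp (-(((1 : ℕ) : ℝ) * D.thSR * D.sigma2 / D.rho)) * D.lapInter f 1 *
      D.lapIntra n 1 := mul_pos (mul_pos (Real.exp_pos _) (Real.exp_pos _)) (D.lapIntra_pos n 1)
  have hn : (0 : ℝ) < n + 1 := by positivity
  refine ⟨div_pos (h1.trans_le h.1) hn, (div_le_one hn).2 (h.2.trans ?_)⟩
  have : (0 : ℝ) ≤ n := n.cast_nonneg
  linarith

lemma continuous_condRA (n : ℕ) : Continuous fun f => D.condRA f n := by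
  unfold condRA lapInter
  fun_prop

lemma summable_pRA {f : ℝ} (hf : 0 ≤ f) :
    Summable (fun n : ℕ => cellPMF D.lam (f * D.muZ) n * D.condRA f n) := by
  have hm := mul_nonneg hf D.muZ_pos.le
  refine Summable.of_nonneg_of_le (fun n => mul_nonneg (cellPMF_nonneg D.lam_pos hm n)
    (D.condRA_mem hf n).1.le) (fun n => ?_) (hasSum_cellPMF D.lam_pos hm).summable
  exact mul_le_of_le_one_right (cellPMF_nonneg D.lam_pos hm n) (D.condRA_mem hf n).2

lemma pRA_mem {f : ℝ} (hf : 0 ≤ f) : D.pRA f ∈ Set.Ioc (0 : ℝ) 1 := by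
  have hm := mul_nonneg hf D.muZ_pos.le
  constructor
  · exact (D.summable_pRA hf).tsum_pos (fun n => mul_nonneg (cellPMF_nonneg D.lam_pos hm n)
      (D.condRA_mem hf n).1.le) 0 (mul_pos (cellPMF_zero_pos D.lam_pos hm) (D.condRA_mem hf 0).1)
  · rw [← (hasSum_cellPMF D.lam_pos hm).tsum_eq]
    exact (D.summable_pRA hf).tsum_le_tsum (fun n => mul_le_of_le_one_right
      (cellPMF_nonneg D.lam_pos hm n) (D.condRA_mem hf n).2) (hasSum_cellPMF D.lam_pos hm).summable

lemma continuousOn_pRA : ContinuousOn D.pRA (Set.Icc 0 1) := by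
  have hmu := D.muZ_pos
  have h := ratio_mem D.lam_pos hmu.le
  refine continuousOn_tsum (u := fun n : ℕ =>
    Ring.choose (cVor + n - 1) n * (D.muZ / (D.muZ + D.lam * cVor)) ^ n) (fun n => ?_)
    (hasSum_choose_mul_pow cVor h.1 h.2).summable fun n f hf => ?_
  · refine ContinuousOn.mul ?_ (D.continuous_condRA n).continuousOn
    exact (continuousOn_cellPMF D.lam_pos n).comp (by fun_prop)
      fun f hf => mul_nonneg hf.1 hmu.le
  · have hm := mul_nonneg hf.1 hmu.le
    have hc := D.condRA_mem hf.1 n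
    rw [Real.norm_of_nonneg (mul_nonneg (cellPMF_nonneg D.lam_pos hm n) hc.1.le)]
    exact (mul_le_of_le_one_right (cellPMF_nonneg D.lam_pos hm n) hc.2).trans
      (cellPMF_le D.lam_pos hm (mul_le_of_le_one_left hmu.le hf.2) n)

lemma pTx_mem : D.pTx ∈ Set.Ioo (0 : ℝ) 1 := by
  refine ⟨Real.exp_pos _, Real.exp_lt_one_iff.2 ?_⟩
  have hb := D.beta_pos
  have hth := D.thTx_pos
  have heta : 0 < D.eta - 2 := by linarith [D.eta_gt]
  have h1 : 0 ≤ D.sigma2 * D.thTx / D.rho :=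
    div_nonneg (mul_nonneg D.sigma2_nonneg hth.le) D.rho_pos.le
  have h2 : 0 < ∫ t in (0 : ℝ)..1, t ^ (1 - 2 / D.eta - 1) * (1 + D.thTx * t)⁻¹ := by
    refine intervalIntegral.intervalIntegral_pos_of_pos_on
      (intervalIntegrable_rpow_mul hb (continuousOn_inv_one_add hth.le)) (fun t ht => ?_) one_pos
    have := ht.1
    exact mul_pos (Real.rpow_pos_of_pos ht.1 _) (by positivity)
  rw [D.hyp2F1_eq]
  have h3 : 0 < 2 * D.thTx / (D.eta - 2) * ((1 - 2 / D.eta) *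
    ∫ t in (0 : ℝ)..1, t ^ (1 - 2 / D.eta - 1) * (1 + D.thTx * t)⁻¹) := by positivity
  linarith

variable {D}

lemma IsLoad.le_one {φ : D.Vec} (h : D.IsLoad φ) (j) : φ j ≤ 1 :=
  (Finset.single_le_sum (fun i _ => h.1 i) (Finset.mem_univ j)).trans h.2

lemma IsLoad.granted_nonneg {φ : D.Vec} (h : D.IsLoad φ) :
    0 ≤ D.mu * ∑ k with k ≠ 0 ∧ k ≠ Fin.last D.N, φ k :=
  mul_nonneg D.mu_pos.le (Finset.sum_nonneg fun k _ => h.1 k)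

variable (D)

lemma pAval_mem {φ : D.Vec} (h : D.IsLoad φ) : D.pAval φ ∈ Set.Ioc (0 : ℝ) 1 := by
  have hs := hasSum_cellPMF D.lam_pos h.granted_nonneg
  have h0 := fun n => cellPMF_nonneg D.lam_pos h.granted_nonneg n
  constructor
  · exact (cellPMF_zero_pos D.lam_pos h.granted_nonneg).trans_le
      (Finset.single_le_sum (fun n _ => h0 n) (Finset.mem_range.2 D.q_pos))
  · exact sum_le_hasSum _ (fun n _ => h0 n) hs

lemma continuousOn_pAval : ContinuousOn D.pAval {φ | D.IsLoad φ} := by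
  unfold pAval
  refine continuousOn_finsetSum _ fun n _ => ?_
  exact (continuousOn_cellPMF D.lam_pos n).comp (by fun_prop) fun φ h => h.granted_nonneg

/-- Probability that a device in the request phase enters the granted slots. -/
noncomputable def grant (φ : D.Vec) : ℝ := D.pRA (φ 0) * D.pAval φ

lemma grant_mem {φ : D.Vec} (h : D.IsLoad φ) : D.grant φ ∈ Set.Ioc (0 : ℝ) 1 := by
  have h1 := D.pRA_mem (h.1 0)
  have h2 := D.pAval_mem h
  exact ⟨mul_pos h1.1 h2.1, mul_le_one₀ h1.2 h2.1.le h2.2⟩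

lemma continuousOn_grant : ContinuousOn D.grant {φ | D.IsLoad φ} :=
  (D.continuousOn_pRA.comp (by fun_prop) fun φ h => ⟨h.1 0, h.le_one 0⟩).mul D.continuousOn_pAval

end Network

/-! ### Nonnegative matrices bounded by a left vector -/

section NonnegMatrix

variable {n : Type*} [Fintype n]

lemma vecMul_mono {v w : n → ℝ} {X : Matrix n n ℝ} (h : ∀ i, v i ≤ w i) (hX : ∀ i j, 0 ≤ X i j)
    (j : n) : (v ᵥ* X) j ≤ (w ᵥ* X) j :=
  Finset.sum_le_sum fun i _ => mul_le_mul_of_nonneg_right (h i) (hX i j)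

lemma vecMul_nonneg {v : n → ℝ} {X : Matrix n n ℝ} (h : ∀ i, 0 ≤ v i) (hX : ∀ i j, 0 ≤ X i j)
    (j : n) : 0 ≤ (v ᵥ* X) j :=
  Finset.sum_nonneg fun i _ => mul_nonneg (h i) (hX i j)

lemma mul_entry_nonneg {X Y : Matrix n n ℝ} (hX : ∀ i j, 0 ≤ X i j) (hY : ∀ i j, 0 ≤ Y i j)
    (i j : n) : 0 ≤ (X * Y) i j := vecMul_nonneg (hX i) hY j

lemma mul_entry_le {X X' Y Y' : Matrix n n ℝ} (hX : ∀ i j, 0 ≤ X i j) (hY' : ∀ i j, 0 ≤ Y' i j)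
    (h : ∀ i j, X i j ≤ X' i j) (h' : ∀ i j, Y i j ≤ Y' i j) (i j : n) :
    (X * Y) i j ≤ (X' * Y') i j :=
  Finset.sum_le_sum fun k _ => (mul_le_mul_of_nonneg_left (h' k j) (hX i k)).trans
    (mul_le_mul_of_nonneg_right (h i k) (hY' k j))

/-- `X` is nonnegative and `y X ≤ c y`. For a positive row vector `y` this bounds the spectral radius
of `X` by `c`. -/
structure LeftBound (y : n → ℝ) (c : ℝ) (X : Matrix n n ℝ) : Prop where
  nonneg : ∀ i j, 0 ≤ X i j
  le : ∀ j, (y ᵥ* X) j ≤ c * y j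

namespace LeftBound

variable {y : n → ℝ} {c : ℝ} {X : Matrix n n ℝ}

lemma entry_le (h : LeftBound y c X) (hy : ∀ i, 0 < y i) (i j : n) : X i j ≤ c * y j / y i := by
  rw [le_div_iff₀ (hy i), mul_comm]
  exact (Finset.single_le_sum (f := fun i => y i * X i j)
    (fun i _ => mul_nonneg (hy i).le (h.nonneg i j)) (Finset.mem_univ i)).trans (h.le j)

lemma of_tendsto {ι : Type*} {l : Filter ι} [l.NeBot] {Z : ι → Matrix n n ℝ}
    (h : ∀ᶠ k in l, LeftBound y c (Z k)) (hZ : ∀ i j, Tendsto (fun k => Z k i j) l (𝓝 (X i j))) :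
    LeftBound y c X where
  nonneg i j := ge_of_tendsto (hZ i j) (h.mono fun _ hk => hk.nonneg i j)
  le j := le_of_tendsto (tendsto_finsetSum _ fun i _ => (hZ i j).const_mul (y i))
    (h.mono fun _ hk => hk.le j)

variable [DecidableEq n]

lemma pow (h : LeftBound y c X) (hc : 0 ≤ c) (k : ℕ) : LeftBound y (c ^ k) (X ^ k) := by
  induction k with
  | zero => exact ⟨fun i j => by rw [pow_zero, one_apply]; split_ifs <;> norm_num, by simp⟩
  | succ k ih =>
    refine ⟨fun i j => ?_, fun j => ?_⟩
    · rw [pow_succ]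
      exact mul_entry_nonneg ih.nonneg h.nonneg i j
    · rw [pow_succ, ← vecMul_vecMul]
      have h1 := vecMul_mono (w := c ^ k • y) ih.le h.nonneg j
      rw [smul_vecMul, Pi.smul_apply, smul_eq_mul] at h1
      calc _ ≤ _ := h1
        _ ≤ c ^ k * (c * y j) := by gcongr; exact h.le j
        _ = _ := by ring

section Neumann

variable (h : LeftBound y c X) (hy : ∀ i, 0 < y i) (h0 : 0 ≤ c) (h1 : c < 1)
include h hy h0 h1

lemma summable_pow_entry (i j : n) : Summable fun k : ℕ => (X ^ k) i j := by
  refine Summable.of_nonneg_of_le (fun k => (h.pow h0 k).nonneg i j)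
    (fun k => (h.pow h0 k).entry_le hy i j) ?_
  simp only [mul_div_assoc]
  exact (summable_geometric_of_lt_one h0 h1).mul_right _

lemma summable_pow : Summable fun k : ℕ => X ^ k :=
  Pi.summable.2 fun i => Pi.summable.2 fun j => h.summable_pow_entry hy h0 h1 i j

lemma isUnit_det : IsUnit (1 - X).det := by
  rw [← isUnit_iff_isUnit_det]
  exact IsUnit.of_mul_eq_one _ (h.summable_pow hy h0 h1).one_sub_mul_tsum_pow

lemma inv_eq : (1 - X)⁻¹ = ∑' k : ℕ, X ^ k :=
  inv_eq_right_inv (h.summable_pow hy h0 h1).one_sub_mul_tsum_pow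

lemma hasSum_pow (i j : n) : HasSum (fun k : ℕ => (X ^ k) i j) ((1 - X)⁻¹ i j) := by
  rw [h.inv_eq hy h0 h1]
  exact Pi.hasSum.1 (Pi.hasSum.1 (h.summable_pow hy h0 h1).hasSum i) j

lemma inv_nonneg (i j : n) : 0 ≤ (1 - X)⁻¹ i j :=
  (h.hasSum_pow hy h0 h1 i j).nonneg fun k => (h.pow h0 k).nonneg i j

lemma tendsto_pow (i j : n) : Tendsto (fun k : ℕ => (X ^ k) i j) atTop (𝓝 0) :=
  (h.summable_pow_entry hy h0 h1 i j).tendsto_atTop_zero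

lemma hasSum_vecMul_pow (v : n → ℝ) (j : n) :
    HasSum (fun k : ℕ => (v ᵥ* X ^ k) j) ((v ᵥ* (1 - X)⁻¹) j) :=
  hasSum_sum fun i _ => (h.hasSum_pow hy h0 h1 i j).mul_left (v i)

end Neumann

end LeftBound

end NonnegMatrix

/-! ### Matrix-analytic theory of quasi-birth-death blocks -/

section Blocks

variable {n : Type*} [Fintype n] [DecidableEq n]

/-- The blocks of a quasi-birth-death chain: nonnegative, with stochastic sum. -/
structure Blocks (A₀ A₁ A₂ : Matrix n n ℝ) : Prop where
  up : ∀ i j, 0 ≤ A₀ i j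
  same : ∀ i j, 0 ≤ A₁ i j
  down : ∀ i j, 0 ≤ A₂ i j
  row : (A₀ + A₁ + A₂) *ᵥ 1 = 1

/-- The map whose minimal nonnegative fixed point is the rate matrix. -/
def rateMap (A₀ A₁ A₂ X : Matrix n n ℝ) : Matrix n n ℝ := A₀ + X * A₁ + X ^ 2 * A₂

/-- A positive row vector `y` with `y (A₀ + ζ A₁ + ζ² A₂) ≤ θ ζ y`. It bounds the rate matrix by
`y R ≤ ζ y`, and for `ζ, θ < 1` it certifies geometric decay of the level probabilities. -/
structure Certificate (A₀ A₁ A₂ : Matrix n n ℝ) (y : n → ℝ) (ζ θ : ℝ) : Prop where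
  pos : ∀ i, 0 < y i
  rate_pos : 0 < ζ
  nonneg : 0 ≤ θ
  le : ∀ j, (y ᵥ* A₀) j + ζ * (y ᵥ* A₁) j + ζ ^ 2 * (y ᵥ* A₂) j ≤ θ * ζ * y j

variable {A₀ A₁ A₂ : Matrix n n ℝ} {y : n → ℝ} {ζ θ : ℝ} {X : Matrix n n ℝ}

lemma Blocks.rateMap_nonneg (hA : Blocks A₀ A₁ A₂) (hX : ∀ i j, 0 ≤ X i j) (i j : n) :
    0 ≤ rateMap A₀ A₁ A₂ X i j := by
  rw [rateMap, sq]
  exact add_nonneg (add_nonneg (hA.up i j) (mul_entry_nonneg hX hA.same i j))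
    (mul_entry_nonneg (mul_entry_nonneg hX hX) hA.down i j)

lemma Blocks.rateMap_mono (hA : Blocks A₀ A₁ A₂) {Y : Matrix n n ℝ} (hX : ∀ i j, 0 ≤ X i j)
    (h : ∀ i j, X i j ≤ Y i j) (i j : n) :
    rateMap A₀ A₁ A₂ X i j ≤ rateMap A₀ A₁ A₂ Y i j := by
  have hY := fun i j => (hX i j).trans (h i j)
  simp only [rateMap, sq, Matrix.add_apply]
  have h1 := mul_entry_le hX hA.same h (fun _ _ => le_rfl) i j
  have h2 := mul_entry_le (mul_entry_nonneg hX hX) hA.down (mul_entry_le hX hY h h)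
    (fun _ _ => le_rfl) i j
  linarith

lemma LeftBound.rateMap (hA : Blocks A₀ A₁ A₂) (hc : Certificate A₀ A₁ A₂ y ζ θ) (hθ : θ ≤ 1)
    (hX : LeftBound y ζ X) : LeftBound y ζ (rateMap A₀ A₁ A₂ X) := by
  refine ⟨hA.rateMap_nonneg hX.nonneg, fun j => ?_⟩
  have h1 := vecMul_mono (w := ζ • y) hX.le hA.same j
  have h2 := vecMul_mono (w := ζ ^ 2 • y) (hX.pow hc.rate_pos.le 2).le hA.down j
  have h3 := hc.le j
  have h4 : θ * ζ * y j ≤ ζ * y j := by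
    have := mul_pos hc.rate_pos (hc.pos j)
    nlinarith
  simp only [smul_vecMul, Pi.smul_apply, smul_eq_mul] at h1 h2
  simp only [SCUL.rateMap, vecMul_add, Pi.add_apply, ← vecMul_vecMul] at h1 h2 ⊢
  linarith

omit [DecidableEq n] in
lemma LeftBound.same_add_mul_down (hA : Blocks A₀ A₁ A₂) (hc : Certificate A₀ A₁ A₂ y ζ θ)
    (hX : LeftBound y ζ X) : LeftBound y θ (A₁ + X * A₂) := by
  refine ⟨fun i j => add_nonneg (hA.same i j) (mul_entry_nonneg hX.nonneg hA.down i j),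
    fun j => ?_⟩
  have h1 := vecMul_mono (w := ζ • y) hX.le hA.down j
  have h2 := hc.le j
  have h3 := vecMul_nonneg (fun i => (hc.pos i).le) hA.up j
  simp only [smul_vecMul, Pi.smul_apply, smul_eq_mul] at h1
  rw [vecMul_add, Pi.add_apply, ← vecMul_vecMul]
  refine le_of_mul_le_mul_left ?_ hc.rate_pos
  have h4 := mul_le_mul_of_nonneg_left h1 hc.rate_pos.le
  linarith

/-- The flow up across a level equals the flow down from it: `A₀ e = R A₂ e`. -/
lemma up_mulVec_one (hA : Blocks A₀ A₁ A₂) (hu : IsUnit (1 - X).det)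
    (hfix : X = rateMap A₀ A₁ A₂ X) : A₀ *ᵥ 1 = X *ᵥ (A₂ *ᵥ 1) := by
  have h1 : A₁ *ᵥ 1 = 1 - A₀ *ᵥ 1 - A₂ *ᵥ (1 : n → ℝ) := by
    have := hA.row
    rw [add_mulVec, add_mulVec] at this
    linear_combination this
  have h2 : (1 - X) *ᵥ (A₀ *ᵥ 1 - X *ᵥ (A₂ *ᵥ 1)) = 0 := by
    have h3 : X *ᵥ 1 = A₀ *ᵥ 1 + X *ᵥ (A₁ *ᵥ 1) + X *ᵥ (X *ᵥ (A₂ *ᵥ 1)) := by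
      conv_lhs => rw [hfix]
      simp only [rateMap, add_mulVec, sq, mulVec_mulVec, Matrix.mul_assoc]
    rw [h1] at h3
    simp only [sub_mulVec, mulVec_sub, one_mulVec] at h3 ⊢
    linear_combination -h3
  have h4 := mulVec_injective_iff_isUnit.2 ((isUnit_iff_isUnit_det _).2 hu)
  exact sub_eq_zero.1 (h4 (by rw [h2, mulVec_zero]))

lemma boundary_mulVec_one (hA : Blocks A₀ A₁ A₂) (hu : IsUnit (1 - X).det)
    (hfix : X = rateMap A₀ A₁ A₂ X) : (1 - A₁ - X * A₂) *ᵥ 1 = A₂ *ᵥ (1 : n → ℝ) := by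
  rw [sub_mulVec, sub_mulVec, one_mulVec, ← mulVec_mulVec, ← up_mulVec_one hA hu hfix]
  have := hA.row
  rw [add_mulVec, add_mulVec] at this
  linear_combination -this

/-- `M⁻¹ A₂`, with `M = I - A₁ - R A₂`, is stochastic, so `|e k| A₂ e` cannot decrease along a
solution of `e k M = e (k + 1) A₂`; if it tends to zero, it vanishes. -/
lemma eq_zero_of_backward_recursion (hdown : ∀ i j, 0 ≤ A₂ i j) {M : Matrix n n ℝ}
    (hu : IsUnit M.det) (hM : ∀ i j, 0 ≤ M⁻¹ i j) (hM1 : M *ᵥ 1 = A₂ *ᵥ (1 : n → ℝ))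
    {e : ℕ → n → ℝ} (he : ∀ k, e k ᵥ* M = e (k + 1) ᵥ* A₂)
    (hlim : ∀ j, Tendsto (fun k => e k j) atTop (𝓝 0)) (k : ℕ) : e k = 0 := by
  set w : n → ℝ := A₂ *ᵥ 1 with hw
  have hwe : ∀ i, w i = ∑ j, A₂ i j := fun i => by simp [hw, mulVec, dotProduct]
  have hrec : ∀ k, e k = e (k + 1) ᵥ* (A₂ * M⁻¹) := fun k => by
    rw [← vecMul_vecMul, ← he, vecMul_vecMul, mul_nonsing_inv _ hu, vecMul_one]
  have hN : (A₂ * M⁻¹) *ᵥ w = w := by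
    rw [← mulVec_mulVec, ← hM1, mulVec_mulVec _ M⁻¹, nonsing_inv_mul _ hu, one_mulVec, hM1]
  have hmono : Monotone fun k => ∑ i, |e k i| * w i := by
    refine monotone_nat_of_le_succ fun k => ?_
    have h1 : ∀ i, |e k i| ≤ ((fun l => |e (k + 1) l|) ᵥ* (A₂ * M⁻¹)) i := fun i => by
      conv_lhs => rw [hrec k]
      refine (Finset.abs_sum_le_sum_abs _ _).trans (Finset.sum_le_sum fun l _ => ?_)
      rw [abs_mul, abs_of_nonneg (mul_entry_nonneg hdown hM l i)]
    have h2 : ∑ i, |e k i| * w i ≤ ((fun l => |e (k + 1) l|) ᵥ* (A₂ * M⁻¹)) ⬝ᵥ w :=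
      Finset.sum_le_sum fun i _ => mul_le_mul_of_nonneg_right (h1 i) (by
        rw [hwe]; exact Finset.sum_nonneg fun j _ => hdown i j)
    rwa [← dotProduct_mulVec, hN] at h2
  have hlim' : Tendsto (fun k => ∑ i, |e k i| * w i) atTop (𝓝 0) := by
    have := tendsto_finsetSum Finset.univ fun i (_ : i ∈ Finset.univ) =>
      ((hlim i).abs.mul_const (w i))
    simpa using this
  have hz : ∀ k i j, e k i * A₂ i j = 0 := by
    intro k i j
    have h1 := hmono.ge_of_tendsto hlim' k
    have hpos : ∀ i, 0 ≤ |e k i| * w i := fun i => mul_nonneg (abs_nonneg _) (by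
      rw [hwe]; exact Finset.sum_nonneg fun j _ => hdown i j)
    have h2 : |e k i| * w i = 0 := le_antisymm
      ((Finset.single_le_sum (fun i _ => hpos i) (Finset.mem_univ i)).trans h1) (hpos i)
    rcases mul_eq_zero.1 h2 with h3 | h3
    · rw [abs_eq_zero.1 h3, zero_mul]
    · rw [hwe] at h3
      rw [(Finset.sum_eq_zero_iff_of_nonneg fun j _ => hdown i j).1 h3 j (Finset.mem_univ j),
        mul_zero]
  have h0 : e (k + 1) ᵥ* A₂ = 0 := funext fun j => Finset.sum_eq_zero fun i _ => hz (k + 1) i j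
  rw [hrec k, ← vecMul_vecMul, h0, zero_vecMul]

section Decay

variable (hA : Blocks A₀ A₁ A₂) (hc : Certificate A₀ A₁ A₂ y ζ θ) (hθ : θ < 1)
  (hX : LeftBound y ζ X)
include hA hc hθ hX

lemma isUnit_det_boundary : IsUnit (1 - A₁ - X * A₂).det := by
  rw [sub_sub]
  exact (hX.same_add_mul_down hA hc).isUnit_det hc.pos hc.nonneg hθ

lemma boundary_inv_nonneg (i j : n) : 0 ≤ (1 - A₁ - X * A₂)⁻¹ i j := by
  rw [sub_sub]
  exact (hX.same_add_mul_down hA hc).inv_nonneg hc.pos hc.nonneg hθ i j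

variable (hζ : ζ < 1)
include hζ

/-- Summable sequences of level vectors that are balanced at all levels are geometric with ratio the
rate matrix. -/
lemma geometric_of_balance (hfix : X = rateMap A₀ A₁ A₂ X) {Y : ℕ → n → ℝ} {c : n → ℝ}
    (h0 : Y 0 = c + Y 0 ᵥ* A₁ + Y 1 ᵥ* A₂)
    (hs : ∀ m, Y (m + 1) = Y m ᵥ* A₀ + Y (m + 1) ᵥ* A₁ + Y (m + 2) ᵥ* A₂)
    (hlim : ∀ j, Tendsto (fun m => Y m j) atTop (𝓝 0)) :
    Y 0 = c ᵥ* (1 - A₁ - X * A₂)⁻¹ ∧ ∀ m, Y m = Y 0 ᵥ* X ^ m := by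
  have hu := isUnit_det_boundary hA hc hθ hX
  have hu1 := hX.isUnit_det hc.pos hc.rate_pos.le hζ
  have hXM : X * (1 - A₁ - X * A₂) = A₀ := by
    conv_lhs => rw [mul_sub, mul_sub, mul_one, ← mul_assoc, ← sq]
    conv_lhs => enter [1, 1]; rw [hfix]
    rw [rateMap]; abel
  have he := eq_zero_of_backward_recursion hA.down hu (boundary_inv_nonneg hA hc hθ hX)
    (boundary_mulVec_one hA hu1 hfix) (e := fun m => Y (m + 1) - Y m ᵥ* X) (fun m => ?_)
    (fun j => ?_)
  · have hstep : ∀ m, Y (m + 1) = Y m ᵥ* X := fun m => sub_eq_zero.1 (he m)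
    refine ⟨?_, fun m => ?_⟩
    · have h1 : Y 0 ᵥ* (1 - A₁ - X * A₂) = c := by
        have h2 := h0
        rw [hstep 0, vecMul_vecMul] at h2
        rw [vecMul_sub, vecMul_sub, vecMul_one]
        conv_lhs => enter [1, 1]; rw [h2]
        abel
      rw [← h1, vecMul_vecMul, mul_nonsing_inv _ hu, vecMul_one]
    · induction m with
      | zero => simp
      | succ m ih => rw [hstep, ih, vecMul_vecMul, pow_succ]
  · have h1 : (Y m ᵥ* X) ᵥ* (1 - A₁ - X * A₂) = Y m ᵥ* A₀ := by rw [vecMul_vecMul, hXM]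
    have h2 : Y (m + 1) ᵥ* (1 - A₁ - X * A₂)
        = Y m ᵥ* A₀ + Y (m + 2) ᵥ* A₂ - (Y (m + 1) ᵥ* X) ᵥ* A₂ := by
      rw [vecMul_sub, vecMul_sub, vecMul_one, vecMul_vecMul]
      conv_lhs => enter [1, 1]; rw [hs m]
      abel
    simp only [sub_vecMul]
    rw [h1, h2]
    abel
  · have h1 : Tendsto (fun m => (Y m ᵥ* X) j) atTop (𝓝 0) := by
      have := tendsto_finsetSum Finset.univ fun i (_ : i ∈ Finset.univ) =>
        ((hlim i).mul_const (X i j))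
      simpa [vecMul, dotProduct] using this
    simpa using ((tendsto_add_atTop_iff_nat 1).2 (hlim j)).sub h1

/-- A certificate with `ζ, θ < 1` admits only one solution of `R = A₀ + R A₁ + R² A₂` below it. -/
lemma rateMap_fixed_unique (hfix : X = rateMap A₀ A₁ A₂ X) {X' : Matrix n n ℝ}
    (hX' : LeftBound y ζ X') (hfix' : X' = rateMap A₀ A₁ A₂ X') : X' = X := by
  have hu := isUnit_det_boundary hA hc hθ hX
  have hu1 := hX.isUnit_det hc.pos hc.rate_pos.le hζ
  have hD : (X' - X) * (1 - A₁ - X * A₂) = X' * (X' - X) * A₂ := by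
    have h1 : X' - X = rateMap A₀ A₁ A₂ X' - rateMap A₀ A₁ A₂ X := by rw [← hfix, ← hfix']
    have h2 : (X' - X) * (1 - A₁ - X * A₂)
        = (X' - X) - (X' - X) * A₁ - (X' - X) * X * A₂ := by noncomm_ring
    rw [h2]
    conv_lhs => enter [1, 1]; rw [h1]
    simp only [rateMap]
    noncomm_ring
  have key : ∀ i, (X' - X) i = 0 := by
    intro i
    have := eq_zero_of_backward_recursion hA.down hu (boundary_inv_nonneg hA hc hθ hX)
      (boundary_mulVec_one hA hu1 hfix) (e := fun k => (X' ^ k * (X' - X)) i) (fun k => ?_)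
      (fun j => ?_) 0
    · simpa using this
    · change (X' ^ k * (X' - X) * (1 - A₁ - X * A₂)) i = (X' ^ (k + 1) * (X' - X) * A₂) i
      rw [mul_assoc, hD, pow_succ]
      simp only [mul_assoc]
    · have := tendsto_finsetSum Finset.univ fun l (_ : l ∈ Finset.univ) =>
        ((hX'.tendsto_pow hc.pos hc.rate_pos.le hζ i l).mul_const ((X' - X) l j))
      simpa [Matrix.mul_apply] using this
  exact sub_eq_zero.1 (funext key)

end Decay

end Blocks

namespace Network

variable (D : Network)

/-! ### The phase process -/

lemma one_ne_zero_phase : (1 : Fin (D.N + 1)) ≠ 0 := by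
  rw [Ne, Fin.one_eq_zero_iff]
  have := D.N_pos
  omega

/-- The cyclic successor carries the granted slots `1, …, N` to `2, …, N, 0`; this is the vector of
the masses that so arrive at a phase. -/
def fromSlot (v : D.Vec) : D.Vec := fun j => if j = 1 then 0 else v (j - 1)

lemma sum_cyclic (f : Fin (D.N + 1) → ℝ) (j : Fin (D.N + 1)) :
    (∑ i, if i ≠ 0 ∧ j = i + 1 then f i else 0) = D.fromSlot f j := by
  rw [fromSlot, Finset.sum_eq_single (j - 1)]
  · by_cases h : j = 1
    · simp [h]
    · simp [h, sub_eq_zero]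
  · intro i _ hi
    rw [if_neg]
    rintro ⟨-, rfl⟩
    simp at hi
  · simp

lemma S_apply (φ : D.Vec) (i j : Fin (D.N + 1)) : D.S φ i j =
    (if i = 0 then (if j = 0 then 1 - D.grant φ else if j = 1 then D.grant φ else 0) else 0) +
      if i ≠ 0 ∧ j = i + 1 then 1 - D.pTx else 0 := by
  by_cases hi : i = 0
  · simp only [S, hi, if_true, ne_eq, not_true_eq_false, false_and, if_false, add_zero, grant]
    split_ifs <;> ring
  · simp [S, hi]

lemma vecMul_S (φ v : D.Vec) (j : Fin (D.N + 1)) : (v ᵥ* D.S φ) j =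
    v 0 * (if j = 0 then 1 - D.grant φ else if j = 1 then D.grant φ else 0) +
      (1 - D.pTx) * D.fromSlot v j := by
  simp only [vecMul, dotProduct, S_apply, mul_add, Finset.sum_add_distrib]
  congr 1
  · rw [Finset.sum_eq_single 0] <;> simp +contextual
  · rw [← sum_cyclic, Finset.mul_sum]
    refine Finset.sum_congr rfl fun i _ => ?_
    split_ifs <;> ring

lemma vecMul_G (v : D.Vec) (j : Fin (D.N + 1)) :
    (v ᵥ* D.G) j = D.pTx * D.fromSlot v j := by
  simp only [vecMul, dotProduct, G]
  rw [← sum_cyclic, Finset.mul_sum]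
  refine Finset.sum_congr rfl fun i _ => ?_
  split_ifs <;> ring

lemma G_mulVec_one : D.G *ᵥ 1 = fun i => if i = 0 then 0 else D.pTx := by
  funext i
  by_cases hi : i = 0 <;> simp [mulVec, dotProduct, G, hi]

lemma S_mulVec_one (φ : D.Vec) : D.S φ *ᵥ 1 = fun i => if i = 0 then 1 else 1 - D.pTx := by
  funext i
  have h1 := D.one_ne_zero_phase
  by_cases hi : i = 0
  · have h : ∀ j : Fin (D.N + 1),
        (if j = 0 then 1 - D.grant φ else if j = 1 then D.grant φ else 0)
          = (if j = 0 then 1 - D.grant φ else 0) + if j = 1 then D.grant φ else 0 := by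
      intro j
      by_cases hj : j = 0
      · simp [hj, h1.symm]
      · simp [hj]
    simp [mulVec, dotProduct, S_apply, hi, h, Finset.sum_add_distrib]
  · simp [mulVec, dotProduct, S_apply, hi]

lemma phase_induction {P : Fin (D.N + 1) → Prop} (h1 : P 1)
    (h : ∀ j, j ≠ 0 → j ≠ 1 → P (j - 1) → P j) (j : Fin (D.N + 1)) (hj : j ≠ 0) : P j := by
  obtain ⟨k, hk⟩ : ∃ k, j.val = k + 1 :=
    Nat.exists_eq_succ_of_ne_zero fun e => hj (Fin.ext e)
  have hN := D.N_pos
  have h1v : (1 : Fin (D.N + 1)).val = 1 := by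
    rw [Fin.val_one']; exact Nat.mod_eq_of_lt (by omega)
  induction k generalizing j with
  | zero =>
    have : j = 1 := Fin.ext (by omega)
    rwa [this]
  | succ k ih =>
    have hj1 : j ≠ 1 := fun e => by rw [e, h1v] at hk; omega
    have hv : (j - 1).val = k + 1 := by
      rw [Fin.val_sub_one_of_ne_zero hj]; omega
    refine h j hj hj1 (ih (j - 1) (fun e => ?_) hv)
    rw [e] at hv
    simp at hv

/-- Sum over the granted slots. -/
def slots (v : D.Vec) : ℝ := ∑ i : Fin D.N, v i.succ

lemma sum_eq_slots (v : D.Vec) : ∑ j, v j = v 0 + D.slots v := Fin.sum_univ_succ _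

lemma dotProduct_slots (v : D.Vec) (b c : ℝ) :
    v ⬝ᵥ (fun i => if i = 0 then b else c) = b * v 0 + c * D.slots v := by
  simp only [dotProduct, Fin.sum_univ_succ, slots, Finset.mul_sum]
  simp [mul_comm]

lemma A0_mulVec_one (φ : D.Vec) :
    D.A0 φ *ᵥ 1 = fun i => if i = 0 then D.a else D.a * (1 - D.pTx) := by
  funext i
  rw [A0, smul_mulVec, S_mulVec_one, Pi.smul_apply, smul_eq_mul]
  split_ifs <;> ring

lemma A2_mulVec_one : D.A2 *ᵥ 1 = fun i => if i = 0 then 0 else (1 - D.a) * D.pTx := by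
  funext i
  rw [A2, smul_mulVec, G_mulVec_one, Pi.smul_apply, smul_eq_mul]
  split_ifs <;> ring

lemma E_eq (φ : D.Vec) : D.E φ = D.A2 *ᵥ 1 := by
  funext i
  rw [E, A2_mulVec_one, S_mulVec_one]
  by_cases hi : i = 0 <;> simp [hi]

lemma sum_blocks (φ : D.Vec) : D.A0 φ + D.A1 φ + D.A2 = D.S φ + D.G := by
  rw [A0, A1, A2]; module

lemma vecMul_sum_blocks (φ v : D.Vec) (j : Fin (D.N + 1)) :
    (v ᵥ* (D.A0 φ + D.A1 φ + D.A2)) j =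
      v 0 * (if j = 0 then 1 - D.grant φ else if j = 1 then D.grant φ else 0) +
        D.fromSlot v j := by
  rw [sum_blocks, vecMul_add, Pi.add_apply, vecMul_S, vecMul_G]
  ring

lemma C_dotProduct_one : D.C ⬝ᵥ 1 = D.a := by
  simp [dotProduct, C]

lemma C_nonneg (j : Fin (D.N + 1)) : 0 ≤ D.C j := by
  rw [C]; split_ifs; exacts [D.a_nonneg, le_rfl]

variable {D}

lemma IsLoad.S_nonneg {φ : D.Vec} (h : D.IsLoad φ) (i j : Fin (D.N + 1)) : 0 ≤ D.S φ i j := by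
  have h1 := D.grant_mem h
  have h2 := D.pTx_mem
  rw [S_apply]
  refine add_nonneg ?_ ?_
  · split_ifs <;> linarith [h1.1, h1.2]
  · split_ifs <;> linarith [h2.1, h2.2]

lemma IsLoad.blocks {φ : D.Vec} (h : D.IsLoad φ) : Blocks (D.A0 φ) (D.A1 φ) D.A2 := by
  have hG : ∀ i j, 0 ≤ D.G i j := fun i j => by
    rw [G]; split_ifs; exacts [D.pTx_mem.1.le, le_rfl]
  have ha := D.a_nonneg
  have ha' : 0 ≤ 1 - D.a := sub_nonneg.2 D.a_le
  refine ⟨fun i j => mul_nonneg ha (h.S_nonneg i j), fun i j => ?_,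
    fun i j => mul_nonneg ha' (hG i j), ?_⟩
  · exact add_nonneg (mul_nonneg ha (hG i j)) (mul_nonneg ha' (h.S_nonneg i j))
  · rw [sum_blocks, add_mulVec, S_mulVec_one, G_mulVec_one]
    funext i
    simp only [Pi.add_apply, Pi.one_apply]
    split_ifs <;> ring

lemma nu_eq (φ : D.Vec) : D.nu φ = fun j => if j = 0 then 1 / (1 + D.N * D.grant φ)
    else 1 / (1 + D.N * D.grant φ) * D.grant φ := rfl

lemma slots_nu (φ : D.Vec) :
    D.slots (D.nu φ) = D.N * (1 / (1 + D.N * D.grant φ) * D.grant φ) := by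
  simp [slots, nu_eq]

/-- The stability condition compares the arrival probability with the service rate
`N r p / (1 + N r)`. -/
lemma IsLoad.stable_iff {φ : D.Vec} (h : D.IsLoad φ) :
    D.Stable φ ↔ D.a * (1 + D.N * D.grant φ) < D.N * D.grant φ * D.pTx := by
  have hr := D.grant_mem h
  have hpos : 0 < 1 + D.N * D.grant φ := by have := hr.1; positivity
  have h1 : D.a • (D.S φ *ᵥ 1) = fun i => if i = 0 then D.a else D.a * (1 - D.pTx) := by
    rw [← D.A0_mulVec_one φ, A0, smul_mulVec]
  have h2 : (1 - D.a) • (D.G *ᵥ 1) = fun i => if i = 0 then 0 else (1 - D.a) * D.pTx := by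
    rw [← D.A2_mulVec_one, A2, smul_mulVec]
  have h0 : D.nu φ 0 = 1 / (1 + D.N * D.grant φ) := by simp [nu_eq]
  rw [Stable, h1, h2, dotProduct_slots, dotProduct_slots, slots_nu, h0,
    ← mul_lt_mul_iff_left₀ hpos]
  have e1 : (D.a * (1 / (1 + D.N * D.grant φ)) + D.a * (1 - D.pTx) *
      (D.N * (1 / (1 + D.N * D.grant φ) * D.grant φ))) * (1 + D.N * D.grant φ)
      = D.a + D.a * (1 - D.pTx) * (D.N * D.grant φ) := by field_simp
  have e2 : (0 * (1 / (1 + D.N * D.grant φ)) + (1 - D.a) * D.pTx *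
      (D.N * (1 / (1 + D.N * D.grant φ) * D.grant φ))) * (1 + D.N * D.grant φ)
      = (1 - D.a) * D.pTx * (D.N * D.grant φ) := by field_simp; ring
  rw [e1, e2]
  constructor <;> intro h <;> linarith

lemma IsLoad.nu_iff {φ : D.Vec} (h : D.IsLoad φ) (v : D.Vec) :
    (v ᵥ* (D.A0 φ + D.A1 φ + D.A2) = v ∧ v ⬝ᵥ 1 = 1) ↔ v = D.nu φ := by
  have hr := D.grant_mem h
  have hpos : 0 < 1 + D.N * D.grant φ := by have := hr.1; positivity
  have h10 := D.one_ne_zero_phase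
  constructor
  · rintro ⟨h1, h2⟩
    have hv : ∀ j, j ≠ 0 → v j = D.grant φ * v 0 := by
      refine D.phase_induction ?_ fun j hj0 hj1 ih => ?_
      · have := congrFun h1 1
        rw [vecMul_sum_blocks] at this
        simp only [h10, if_false, if_true, fromSlot, add_zero] at this
        linarith
      · have := congrFun h1 j
        rw [vecMul_sum_blocks] at this
        simp only [hj0, hj1, if_false, fromSlot, mul_zero, zero_add] at this
        rw [← this, ih]
    have hs : D.slots v = D.N * (D.grant φ * v 0) := by
      simp [slots, hv _ (Fin.succ_ne_zero _)]
    rw [dotProduct_one, sum_eq_slots, hs] at h2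
    have h0 : v 0 = 1 / (1 + D.N * D.grant φ) := by
      rw [eq_div_iff hpos.ne']; linarith
    funext j
    rw [nu_eq]
    by_cases hj : j = 0
    · simp [hj, h0]
    · simp only [hj, if_false]
      rw [hv j hj, h0, mul_comm]
  · rintro rfl
    constructor
    · funext j
      rw [vecMul_sum_blocks]
      by_cases hj : j = 0
      · subst hj
        have h1 : (0 : Fin (D.N + 1)) - 1 ≠ 0 := by simpa using h10
        simp only [if_true, fromSlot, h10.symm, if_false, nu_eq, h1]
        ring
      · by_cases hj1 : j = 1
        · simp [nu_eq, fromSlot, hj1, h10]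
        · simp [nu_eq, fromSlot, hj1, hj, sub_eq_zero]
    · rw [dotProduct_one, sum_eq_slots, slots_nu]
      simp only [nu_eq, if_true]
      field_simp

lemma vecMul_certificate (φ y : D.Vec) (ζ : ℝ) (j : Fin (D.N + 1)) :
    (y ᵥ* D.A0 φ) j + ζ * (y ᵥ* D.A1 φ) j + ζ ^ 2 * (y ᵥ* D.A2) j =
      (D.a + (1 - D.a) * ζ) *
        (y 0 * (if j = 0 then 1 - D.grant φ else if j = 1 then D.grant φ else 0) +
          (1 - D.pTx + D.pTx * ζ) * D.fromSlot y j) := by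
  simp only [A0, A1, A2, vecMul_add, vecMul_smul, Pi.add_apply, Pi.smul_apply, smul_eq_mul,
    vecMul_S, vecMul_G]
  ring

lemma IsLoad.nu_pos {φ : D.Vec} (h : D.IsLoad φ) (j : Fin (D.N + 1)) : 0 < D.nu φ j := by
  have hr := (D.grant_mem h).1
  rw [nu_eq]
  dsimp only
  split_ifs <;> positivity

/-- The stationary phase distribution bounds the rate matrix whether or not the chain is stable. -/
lemma IsLoad.certificate_nu {φ : D.Vec} (h : D.IsLoad φ) :
    Certificate (D.A0 φ) (D.A1 φ) D.A2 (D.nu φ) 1 1 := by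
  refine ⟨h.nu_pos, one_pos, zero_le_one, fun j => ?_⟩
  have := congrFun ((h.nu_iff _).2 rfl).1 j
  rw [vecMul_add, vecMul_add, Pi.add_apply, Pi.add_apply] at this
  linarith

/-- The characteristic inequality of the stable chain has a solution below `1`: at `ζ = θ = 1` both
sides agree, and the derivative there has the sign of the drift. -/
lemma exists_rate {a r p : ℝ} (N : ℕ) (hs : a * (1 + N * r) < N * r * p) :
    ∃ ζ θ : ℝ, 0 < ζ ∧ ζ < 1 ∧ 0 < θ ∧ θ < 1 ∧
      (a + (1 - a) * ζ) / (θ * ζ) * (1 - r) + (a + (1 - a) * ζ) / (θ * ζ) * r *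
        ((a + (1 - a) * ζ) / (θ * ζ) * (1 - p + p * ζ)) ^ N < 1 := by
  obtain ⟨ζ, h0, h1, h2⟩ : ∃ ζ : ℝ, 0 < ζ ∧ ζ < 1 ∧
      (a + (1 - a) * ζ) / ζ * (1 - r) + (a + (1 - a) * ζ) / ζ * r *
        ((a + (1 - a) * ζ) / ζ * (1 - p + p * ζ)) ^ N < 1 := by
    have hg : HasDerivAt (fun ζ : ℝ => (a + (1 - a) * ζ) / ζ) (-a) 1 := by
      have := (((hasDerivAt_id (1 : ℝ)).const_mul (1 - a)).const_add a).div
        (hasDerivAt_id (1 : ℝ)) one_ne_zero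
      refine this.congr_deriv ?_
      simp
    have ht : HasDerivAt (fun ζ : ℝ => 1 - p + p * ζ) p 1 := by
      simpa using ((hasDerivAt_id (1 : ℝ)).const_mul p).const_add (1 - p)
    have hd : HasDerivAt (fun ζ : ℝ => (a + (1 - a) * ζ) / ζ * (1 - r) +
        (a + (1 - a) * ζ) / ζ * r * ((a + (1 - a) * ζ) / ζ * (1 - p + p * ζ)) ^ N) _ 1 :=
      (hg.mul_const (1 - r)).add ((hg.mul_const r).mul ((hg.mul ht).pow N))
    have hl := (hasDerivWithinAt_iff_tendsto_slope' (s := Set.Iio (1 : ℝ)) (by simp)).1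
      hd.hasDerivWithinAt
    have hpos : ∀ᶠ ζ in 𝓝[<] (1 : ℝ), 0 < slope (fun ζ : ℝ =>
        (a + (1 - a) * ζ) / ζ * (1 - r) + (a + (1 - a) * ζ) / ζ * r *
          ((a + (1 - a) * ζ) / ζ * (1 - p + p * ζ)) ^ N) 1 ζ := hl.eventually_const_lt (by
      simp
      linarith)
    have hz : ∀ᶠ ζ in 𝓝[<] (1 : ℝ), 0 < ζ :=
      (eventually_gt_nhds one_pos).filter_mono nhdsWithin_le_nhds
    obtain ⟨ζ, ⟨hζ, hζ0⟩, hζ1⟩ := ((hpos.and hz).and self_mem_nhdsWithin).exists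
    refine ⟨ζ, hζ0, hζ1, ?_⟩
    rw [slope_def_field] at hζ
    have hneg := ((div_pos_iff.1 hζ).resolve_left fun h => (sub_neg.2 hζ1).not_gt h.2).1
    simpa [sub_neg] using hneg
  have hcont : ContinuousAt (fun θ : ℝ => (a + (1 - a) * ζ) / (θ * ζ) * (1 - r) +
      (a + (1 - a) * ζ) / (θ * ζ) * r *
        ((a + (1 - a) * ζ) / (θ * ζ) * (1 - p + p * ζ)) ^ N) 1 := by
    have : ContinuousAt (fun θ : ℝ => (a + (1 - a) * ζ) / (θ * ζ)) 1 :=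
      continuousAt_const.div (by fun_prop) (by simpa using h0.ne')
    fun_prop
  have hev : ∀ᶠ θ in 𝓝[<] (1 : ℝ), (a + (1 - a) * ζ) / (θ * ζ) * (1 - r) +
      (a + (1 - a) * ζ) / (θ * ζ) * r *
        ((a + (1 - a) * ζ) / (θ * ζ) * (1 - p + p * ζ)) ^ N < 1 :=
    (hcont.eventually_lt continuousAt_const (by simpa using h2)).filter_mono nhdsWithin_le_nhds
  have hz : ∀ᶠ θ in 𝓝[<] (1 : ℝ), 0 < θ :=
    (eventually_gt_nhds one_pos).filter_mono nhdsWithin_le_nhds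
  obtain ⟨θ, ⟨hθ, hθ0⟩, hθ1⟩ := ((hev.and hz).and self_mem_nhdsWithin).exists
  exact ⟨ζ, θ, h0, h1, hθ0, hθ1, hθ⟩

lemma IsLoad.exists_certificate {φ : D.Vec} (h : D.IsLoad φ) (hs : D.Stable φ) :
    ∃ (y : D.Vec) (ζ θ : ℝ), Certificate (D.A0 φ) (D.A1 φ) D.A2 y ζ θ ∧ ζ < 1 ∧ θ < 1 := by
  obtain ⟨ζ, θ, h0, h1, hθ0, hθ1, hlt⟩ := exists_rate D.N (h.stable_iff.1 hs)
  have hr := (D.grant_mem h).1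
  have hp := D.pTx_mem
  have ha := D.a_nonneg
  have ha' := D.a_le
  have h10 := D.one_ne_zero_phase
  set b := D.a + (1 - D.a) * ζ with hb
  set t := 1 - D.pTx + D.pTx * ζ with ht
  have hb0 : 0 < b := by nlinarith
  have ht0 : 0 < t := by nlinarith [hp.1, hp.2]
  set g := b / (θ * ζ) with hg
  have hg0 : 0 < g := by positivity
  have hgb : b = θ * ζ * g := by rw [hg]; field_simp
  -- equality in the phases `1, …, N` forces this geometric profile
  refine ⟨fun j => if j = 0 then 1 else g * D.grant φ * (g * t) ^ (j.val - 1), ζ, θ,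
    ⟨fun j => ?_, h0, hθ0.le, fun j => ?_⟩, h1, hθ1⟩
  · split_ifs <;> positivity
  · rw [vecMul_certificate, ← hb, ← ht, hgb]
    by_cases hj : j = 0
    · subst hj
      have hl : (0 : Fin (D.N + 1)) - 1 ≠ 0 := by simpa using h10
      have hv : ((0 : Fin (D.N + 1)) - 1).val = D.N := by
        rw [zero_sub, Fin.coe_neg_one]
      simp only [if_true, fromSlot, h10.symm, if_false, hl, hv]
      have e : (g * t) ^ D.N = (g * t) ^ (D.N - 1) * (g * t) := by
        rw [← pow_succ, Nat.sub_add_cancel D.N_pos]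
      rw [e] at hlt
      have := mul_le_mul_of_nonneg_left hlt.le (mul_pos hθ0 h0).le
      linarith
    · have hv : (j - 1).val = j.val - 1 := Fin.val_sub_one_of_ne_zero hj
      by_cases hj1 : j = 1
      · have h1v : (1 : Fin (D.N + 1)).val = 1 := by
          rw [Fin.val_one']; exact Nat.mod_eq_of_lt (by have := D.N_pos; omega)
        simp only [hj1, h10, if_true, if_false, fromSlot, h1v]
        apply le_of_eq; ring
      · have hj2 : j - 1 ≠ 0 := by simpa [sub_eq_zero] using hj1
        obtain ⟨k, hk⟩ : ∃ k, (j - 1).val = k + 1 :=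
          Nat.exists_eq_succ_of_ne_zero fun e => hj2 (Fin.ext e)
        have hk' : j.val - 1 = k + 1 := by omega
        simp only [hj, hj1, hj2, if_true, if_false, fromSlot, hk, hk', Nat.add_sub_cancel]
        apply le_of_eq; ring

/-! ### Stationary distributions in terms of level vectors -/

lemma hasSum_state {f : D.State → ℝ} {s : Fin (D.N + 1) → ℝ}
    (h : ∀ j, HasSum (fun l : ℕ => f (some (l, j))) (s j)) : HasSum f (f none + ∑ j, s j) := by
  have h1 : HasSum (fun q : ℕ × Fin (D.N + 1) => f (some q)) (∑ j, s j) := by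
    have h2 : ∀ j, HasSum (fun q : ℕ × Fin (D.N + 1) => if q.2 = j then f (some q) else 0) (s j) := by
      intro j
      have hinj : Function.Injective (fun l : ℕ => (l, j)) := fun _ _ e => congrArg Prod.fst e
      refine (hinj.hasSum_iff fun q hq => ?_).1 (by simpa [Function.comp_def] using h j)
      rw [if_neg]
      rintro rfl
      exact hq ⟨q.1, rfl⟩
    have h3 := hasSum_sum (s := Finset.univ) fun j _ => h2 j
    simpa using h3
  have h4 : HasSum (fun s : D.State => if s = none then f none else 0) (f none) :=
    hasSum_ite_eq none (f none)
  have h5 : HasSum (fun s : D.State => if s = none then 0 else f s) (∑ j, s j) := by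
    refine ((Option.some_injective _).hasSum_iff fun s hs => ?_).1
      (by simpa [Function.comp_def] using h1)
    cases s with
    | none => simp
    | some q => exact absurd ⟨q, rfl⟩ hs
  refine (h4.add h5).congr_fun fun s => ?_
  cases s <;> simp

/-- The balance equations of the chain, written with the idle probability `x₀` and the vectors `Y l`
of the probabilities of the states with `l + 1` packets. -/
structure Balanced (φ : D.Vec) (x₀ : ℝ) (Y : ℕ → D.Vec) : Prop where
  idle : x₀ = x₀ * (1 - D.a) + Y 0 ⬝ᵥ (D.A2 *ᵥ 1)
  first : Y 0 = x₀ • D.C + Y 0 ᵥ* D.A1 φ + Y 1 ᵥ* D.A2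
  step : ∀ m, Y (m + 1) = Y m ᵥ* D.A0 φ + Y (m + 1) ᵥ* D.A1 φ + Y (m + 2) ᵥ* D.A2

lemma hasSum_trans_none (φ : D.Vec) (x : D.State → ℝ) :
    HasSum (fun s => x s * D.trans φ s none)
      (x none * (1 - D.a) + (fun i => x (some (0, i))) ⬝ᵥ (D.A2 *ᵥ 1)) := by
  rw [← D.E_eq φ]
  refine hasSum_state (f := fun s => x s * D.trans φ s none)
    (s := fun i => x (some (0, i)) * D.E φ i) fun j => ?_
  convert hasSum_single (f := fun l : ℕ => x (some (l, j)) * D.trans φ (some (l, j)) none) 0 ?_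
    using 1
  · simp [trans]
  · intro l hl
    simp [trans, hl]

lemma hasSum_trans_zero (φ : D.Vec) (x : D.State → ℝ) (j : Fin (D.N + 1)) :
    HasSum (fun s => x s * D.trans φ s (some (0, j)))
      ((x none • D.C + (fun i => x (some (0, i))) ᵥ* D.A1 φ +
        (fun i => x (some (1, i))) ᵥ* D.A2) j) := by
  have h := hasSum_state (f := fun s => x s * D.trans φ s (some (0, j)))
    (s := fun i => x (some (0, i)) * D.A1 φ i j + x (some (1, i)) * D.A2 i j) fun i => by
    convert hasSum_sum_of_ne_finset_zero (s := {0, 1})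
      (f := fun l : ℕ => x (some (l, i)) * D.trans φ (some (l, i)) (some (0, j))) ?_ using 1
    · simp [trans]
    · intro l hl
      simp only [Finset.mem_insert, Finset.mem_singleton, not_or] at hl
      simp [trans, hl.1, hl.2, eq_comm]
    · infer_instance
  simpa [trans, Finset.sum_add_distrib, add_assoc, vecMul, dotProduct] using h

lemma hasSum_trans_succ (φ : D.Vec) (x : D.State → ℝ) (m : ℕ) (j : Fin (D.N + 1)) :
    HasSum (fun s => x s * D.trans φ s (some (m + 1, j)))
      (((fun i => x (some (m, i))) ᵥ* D.A0 φ + (fun i => x (some (m + 1, i))) ᵥ* D.A1 φ +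
        (fun i => x (some (m + 2, i))) ᵥ* D.A2) j) := by
  have h := hasSum_state (f := fun s => x s * D.trans φ s (some (m + 1, j)))
    (s := fun i => x (some (m, i)) * D.A0 φ i j + (x (some (m + 1, i)) * D.A1 φ i j +
      x (some (m + 2, i)) * D.A2 i j)) fun i => by
    convert hasSum_sum_of_ne_finset_zero (s := {m, m + 1, m + 2})
      (f := fun l : ℕ => x (some (l, i)) * D.trans φ (some (l, i)) (some (m + 1, j))) ?_ using 1
    · rw [Finset.sum_insert (by simp), Finset.sum_insert (by simp), Finset.sum_singleton]
      simp [trans]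
    · intro l hl
      simp only [Finset.mem_insert, Finset.mem_singleton, not_or] at hl
      have h1 : m ≠ l := Ne.symm hl.1
      have h2 : m + 1 ≠ l := Ne.symm hl.2.1
      have h3 : l ≠ m + 1 + 1 := hl.2.2
      simp [trans, h1, h2, h3]
    · infer_instance
  simpa [trans, Finset.sum_add_distrib, add_assoc, vecMul, dotProduct] using h

lemma balance_iff (φ : D.Vec) (x : D.State → ℝ) :
    (∀ t, HasSum (fun s => x s * D.trans φ s t) (x t)) ↔
      Balanced φ (x none) (fun l j => x (some (l, j))) := by
  constructor
  · intro h
    exact ⟨(h none).unique (hasSum_trans_none φ x),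
      funext fun j => (h (some (0, j))).unique (hasSum_trans_zero φ x j),
      fun m => funext fun j => (h (some (m + 1, j))).unique (hasSum_trans_succ φ x m j)⟩
  · intro h t
    match t with
    | none =>
      have := hasSum_trans_none φ x
      rwa [← h.idle] at this
    | some (0, j) =>
      have := hasSum_trans_zero φ x j
      rwa [← h.first] at this
    | some (m + 1, j) =>
      have := hasSum_trans_succ φ x m j
      rwa [← h.step m] at this

lemma IsStationary.balanced {φ : D.Vec} {x : D.State → ℝ} (h : D.IsStationary φ x) :
    Balanced φ (x none) (fun l j => x (some (l, j))) := (balance_iff φ x).1 h.2.2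

lemma IsStationary.summable_level {φ : D.Vec} {x : D.State → ℝ} (h : D.IsStationary φ x)
    (j : Fin (D.N + 1)) : Summable fun l : ℕ => x (some (l, j)) :=
  h.2.1.summable.comp_injective (i := fun l : ℕ => (some (l, j) : D.State)) fun _ _ e => by
    simpa using e

lemma IsStationary.none_add_sum {φ : D.Vec} {x : D.State → ℝ} (h : D.IsStationary φ x)
    {v : D.Vec} (hv : ∀ j, HasSum (fun l : ℕ => x (some (l, j))) (v j)) :
    x none + ∑ j, v j = 1 := (hasSum_state hv).unique h.2.1

/-- Level vectors that solve the balance equations make up a stationary distribution. -/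
lemma Balanced.isStationary {φ : D.Vec} {x₀ : ℝ} {Y : ℕ → D.Vec} (h : Balanced φ x₀ Y)
    (h0 : 0 ≤ x₀) (hY : ∀ l j, 0 ≤ Y l j) {v : D.Vec} (hv : ∀ j, HasSum (fun l => Y l j) (v j))
    (h1 : x₀ + ∑ j, v j = 1) :
    D.IsStationary φ (fun s => s.elim x₀ fun q => Y q.1 q.2) := by
  refine ⟨fun s => ?_, ?_, (balance_iff φ _).2 h⟩
  · cases s with
    | none => exact h0
    | some q => exact hY _ _
  · rw [← h1]
    exact hasSum_state (f := fun s : D.State => s.elim x₀ fun q => Y q.1 q.2) hv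

lemma Balanced.smul {φ : D.Vec} {x₀ : ℝ} {Y : ℕ → D.Vec} (h : Balanced φ x₀ Y) (c : ℝ) :
    Balanced φ (c * x₀) (fun l => c • Y l) := by
  refine ⟨?_, ?_, fun m => ?_⟩
  · rw [smul_dotProduct, smul_eq_mul]
    linear_combination c * h.idle
  · conv_lhs => rw [h.first]
    simp only [smul_add, smul_vecMul, mul_smul]
  · conv_lhs => rw [h.step m]
    simp only [smul_add, smul_vecMul]

lemma A1_mulVec_one {φ : D.Vec} (h : D.IsLoad φ) :
    D.A1 φ *ᵥ 1 = 1 - D.A0 φ *ᵥ 1 - D.A2 *ᵥ (1 : D.Vec) := by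
  have := h.blocks.row
  rw [add_mulVec, add_mulVec] at this
  linear_combination this

/-- In a balanced state the flow up across each level equals the flow down. -/
lemma Balanced.cut {φ : D.Vec} (hφ : D.IsLoad φ) {x₀ : ℝ} {Y : ℕ → D.Vec}
    (h : Balanced φ x₀ Y) (m : ℕ) :
    Y m ⬝ᵥ (D.A0 φ *ᵥ 1) = Y (m + 1) ⬝ᵥ (D.A2 *ᵥ 1) := by
  induction m with
  | zero =>
    have h1 := congrArg (fun v => v ⬝ᵥ (1 : D.Vec)) h.first
    simp only [add_dotProduct, smul_dotProduct, ← dotProduct_mulVec, A1_mulVec_one hφ,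
      dotProduct_sub, C_dotProduct_one, smul_eq_mul] at h1
    have h2 := h.idle
    rw [zero_add]
    linarith
  | succ m ih =>
    have h1 := congrArg (fun v => v ⬝ᵥ (1 : D.Vec)) (h.step m)
    simp only [add_dotProduct, ← dotProduct_mulVec, A1_mulVec_one hφ, dotProduct_sub] at h1
    linarith

lemma hasSum_vecMul {Y : ℕ → D.Vec} {v : D.Vec} (hv : ∀ j, HasSum (fun l => Y l j) (v j))
    (B : D.Mat) (j : Fin (D.N + 1)) : HasSum (fun l => (Y l ᵥ* B) j) ((v ᵥ* B) j) :=
  hasSum_sum (s := Finset.univ) fun i _ => (hv i).mul_right (B i j)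

lemma Balanced.sum_levels {φ : D.Vec} {x₀ : ℝ} {Y : ℕ → D.Vec} (h : Balanced φ x₀ Y)
    {v : D.Vec} (hv : ∀ j, HasSum (fun l => Y l j) (v j)) :
    v = x₀ • D.C + v ᵥ* (D.A0 φ + D.A1 φ + D.A2) - Y 0 ᵥ* D.A2 := by
  funext j
  have s1 := (hasSum_nat_add_iff' 1).2 (hv j)
  have s2 := hasSum_vecMul hv (D.A0 φ) j
  have s3 := (hasSum_nat_add_iff' 1).2 (hasSum_vecMul hv (D.A1 φ) j)
  have s4 := (hasSum_nat_add_iff' 2).2 (hasSum_vecMul hv D.A2 j)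
  have s5 := s1.unique (((s2.add s3).add s4).congr_fun fun m =>
    congrFun (h.step m) j)
  have h1 := congrFun h.first j
  simp only [Finset.sum_range_succ, Finset.sum_range_zero, zero_add, Pi.add_apply, Pi.sub_apply,
    vecMul_add] at s5 h1 ⊢
  linarith

lemma slots_nonneg {v : D.Vec} (hv : ∀ j, 0 ≤ v j) : 0 ≤ D.slots v :=
  Finset.sum_nonneg fun _ _ => hv _

/-- Mean arrivals equal mean departures. -/
lemma Balanced.arrival_eq {φ : D.Vec} (hφ : D.IsLoad φ) {x₀ : ℝ} {Y : ℕ → D.Vec}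
    (h : Balanced φ x₀ Y) {v : D.Vec} (hv : ∀ j, HasSum (fun l => Y l j) (v j)) :
    D.a * (x₀ + ∑ j, v j) = D.pTx * D.slots v := by
  have hd : ∀ w : D.Vec, HasSum (fun m => Y m ⬝ᵥ w) (v ⬝ᵥ w) := fun w =>
    hasSum_sum (s := Finset.univ) fun i _ => (hv i).mul_right (w i)
  have h1 := (hasSum_nat_add_iff' 1).2 (hd (D.A2 *ᵥ 1))
  have h2 := h1.unique ((hd (D.A0 φ *ᵥ 1)).congr_fun fun m => (h.cut hφ m).symm)
  have h3 := h.idle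
  rw [Finset.sum_range_one] at h2
  rw [sum_eq_slots]
  simp only [A0_mulVec_one, A2_mulVec_one, dotProduct_slots] at h2 h3
  linarith

lemma Balanced.slots_le {φ : D.Vec} (hφ : D.IsLoad φ) {x₀ : ℝ} {Y : ℕ → D.Vec}
    (h : Balanced φ x₀ Y) (hY : ∀ l j, 0 ≤ Y l j) {v : D.Vec}
    (hv : ∀ j, HasSum (fun l => Y l j) (v j)) :
    D.slots v ≤ D.N * (D.grant φ * v 0) := by
  have hs := h.sum_levels hv
  have h10 := D.one_ne_zero_phase
  have hle : ∀ j, j ≠ 0 → v j ≤ D.grant φ * v 0 := by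
    have hj : ∀ j, j ≠ 0 → v j ≤ v 0 * (if j = 1 then D.grant φ else 0) + D.fromSlot v j := by
      intro j hj
      have h1 := congrFun hs j
      have h2 := vecMul_nonneg (hY 0) hφ.blocks.down j
      rw [Pi.sub_apply, Pi.add_apply, vecMul_sum_blocks] at h1
      simp only [Pi.smul_apply, C, hj, if_false, smul_zero, zero_add] at h1
      linarith
    refine D.phase_induction ?_ fun j hj0 hj1 ih => ?_
    · have := hj 1 h10
      simp only [if_true, fromSlot, add_zero] at this
      linarith
    · have := hj j hj0
      simp only [hj1, if_false, fromSlot] at this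
      linarith
  calc D.slots v ≤ ∑ _i : Fin D.N, D.grant φ * v 0 :=
        Finset.sum_le_sum fun i _ => hle _ (Fin.succ_ne_zero i)
    _ = _ := by simp

/-- The idle state is reached from everywhere, so it carries mass. -/
lemma Balanced.eq_zero {φ : D.Vec} (hφ : D.IsLoad φ) (ha : D.a < 1) {Y : ℕ → D.Vec}
    (h : Balanced φ 0 Y) (hY : ∀ l j, 0 ≤ Y l j) (m : ℕ) : Y m = 0 := by
  have hp := D.pTx_mem
  have hr := D.grant_mem hφ
  have h10 := D.one_ne_zero_phase
  have key : ∀ m, Y m ⬝ᵥ (D.A2 *ᵥ 1) = 0 → (∀ j, (Y m ᵥ* D.A1 φ) j ≤ Y m j) → Y m = 0 := by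
    intro m h1 h2
    rw [A2_mulVec_one, dotProduct_slots, zero_mul, zero_add] at h1
    have hs : D.slots (Y m) = 0 := by
      have : (1 - D.a) * D.pTx ≠ 0 := (mul_pos (sub_pos.2 ha) hp.1).ne'
      simpa [this] using h1
    have h3 : ∀ i : Fin D.N, Y m i.succ = 0 := fun i =>
      (Finset.sum_eq_zero_iff_of_nonneg fun i _ => hY m _).1 hs i (Finset.mem_univ i)
    have h4 : ∀ j, j ≠ 0 → Y m j = 0 := fun j hj => by
      obtain ⟨i, rfl⟩ := Fin.exists_succ_eq.2 hj
      exact h3 i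
    have h5 := h2 1
    rw [h4 1 h10, A1, vecMul_add, vecMul_smul, vecMul_smul, Pi.add_apply, Pi.smul_apply,
      Pi.smul_apply, vecMul_G, vecMul_S] at h5
    simp only [fromSlot, h10, if_true, if_false, mul_zero, zero_add, add_zero,
      smul_eq_mul] at h5
    have h6 : Y m 0 = 0 := by
      refine le_antisymm ?_ (hY m 0)
      by_contra hc
      push Not at hc
      have := mul_pos (sub_pos.2 ha) (mul_pos hc hr.1)
      linarith
    funext j
    by_cases hj : j = 0
    · rw [hj, h6]; rfl
    · exact h4 j hj
  induction m with
  | zero =>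
    refine key 0 (by have := h.idle; linarith) fun j => ?_
    have h1 := congrFun h.first j
    have h2 := vecMul_nonneg (hY 1) hφ.blocks.down j
    simp only [Pi.add_apply, zero_smul, Pi.zero_apply] at h1
    linarith
  | succ m ih =>
    refine key (m + 1) (by rw [← h.cut hφ m, ih, zero_dotProduct]) fun j => ?_
    have h1 := congrFun (h.step m) j
    have h2 := vecMul_nonneg (hY (m + 2)) hφ.blocks.down j
    have h3 := vecMul_nonneg (hY m) hφ.blocks.up j
    simp only [Pi.add_apply] at h1
    linarith

/-- Necessity of the stability condition: departures `p V = a`, where the mass `V` of the granted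
slots is at most `N r` times that of the request phase, leave room for an idle state only if `a`
is below the service rate. -/
theorem IsStationary.stable {φ : D.Vec} (hφ : D.IsLoad φ) {x : D.State → ℝ}
    (h : D.IsStationary φ x) : D.Stable φ := by
  have hp := D.pTx_mem
  have hr := D.grant_mem hφ
  obtain ⟨v, hv⟩ : ∃ v : D.Vec, ∀ j, HasSum (fun l : ℕ => x (some (l, j))) (v j) :=
    ⟨_, fun j => (h.summable_level j).hasSum⟩
  have h1 := h.none_add_sum (v := v) hv
  have hb := h.balanced
  have h2 := hb.arrival_eq hφ hv
  have h3 := hb.slots_le hφ (fun l j => h.1 _) hv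
  have hv0 : ∀ j, 0 ≤ v j := fun j => (hv j).nonneg fun l => h.1 _
  have hV := slots_nonneg hv0
  rw [h1, mul_one] at h2
  rw [sum_eq_slots] at h1
  have hx0 : 0 ≤ x none := h.1 none
  have ha : D.a < 1 := by nlinarith [hv0 0, hp.1, hp.2]
  have hpos : 0 < x none := by
    refine lt_of_le_of_ne hx0 fun e => ?_
    rw [← e] at hb
    have hz := hb.eq_zero hφ ha fun l j => h.1 _
    have : v = 0 := funext fun j => by
      have hzj : ∀ l, x (some (l, j)) = 0 := fun l => congrFun (hz l) j
      have := hv j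
      simp only [hzj] at this
      exact this.unique hasSum_zero
    rw [← e, this] at h1
    simp [slots] at h1
  rw [hφ.stable_iff, h2]
  have hN : (0 : ℝ) < D.N := Nat.cast_pos.2 D.N_pos
  have h4 : v 0 = 1 - x none - D.slots v := by linarith
  rw [h4] at h3
  have h5 : 0 < D.N * (D.grant φ * x none) := mul_pos hN (mul_pos hr.1 hpos)
  have h6 : D.slots v * (1 + D.N * D.grant φ) < D.N * D.grant φ := by linarith
  have := mul_lt_mul_of_pos_left h6 hp.1
  linarith

/-! ### The rate matrix -/

/-- The limit of the iterates of the first algorithm. -/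
noncomputable def rateMatrix (D : Network) (φ : D.Vec) : D.Mat := fun i j => ⨆ m, D.rIter φ m i j

/-- Entrywise bounds shared by the iterates and by their limit: every certificate of the chain at `φ`
bounds `X`. -/
def Certified (φ : D.Vec) (X : D.Mat) : Prop :=
  ∀ y ζ θ, Certificate (D.A0 φ) (D.A1 φ) D.A2 y ζ θ → θ ≤ 1 → LeftBound y ζ X

lemma IsLoad.certified_rIter {φ : D.Vec} (h : D.IsLoad φ) (m : ℕ) :
    Certified φ (D.rIter φ m) := by
  intro y ζ θ hc hθ
  induction m with
  | zero =>
    refine ⟨fun i j => le_rfl, fun j => ?_⟩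
    simpa [rIter] using (mul_pos hc.rate_pos (hc.pos j)).le
  | succ m ih => exact ih.rateMap h.blocks hc hθ

lemma IsLoad.rIter_nonneg {φ : D.Vec} (h : D.IsLoad φ) (m : ℕ) (i j) : 0 ≤ D.rIter φ m i j :=
  (h.certified_rIter m _ _ _ h.certificate_nu le_rfl).nonneg i j

lemma IsLoad.rIter_mono {φ : D.Vec} (h : D.IsLoad φ) (i j) : Monotone fun m => D.rIter φ m i j := by
  refine monotone_nat_of_le_succ fun m => ?_
  induction m generalizing i j with
  | zero => exact h.rIter_nonneg 1 i j
  | succ m ih => exact h.blocks.rateMap_mono (h.rIter_nonneg m) ih i j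

lemma IsLoad.tendsto_rIter {φ : D.Vec} (h : D.IsLoad φ) (i j) :
    Tendsto (fun m => D.rIter φ m i j) atTop (𝓝 (D.rateMatrix φ i j)) :=
  tendsto_atTop_ciSup (h.rIter_mono i j) ⟨_, by
    rintro _ ⟨m, rfl⟩
    exact (h.certified_rIter m _ _ _ h.certificate_nu le_rfl).entry_le h.nu_pos i j⟩

lemma tendsto_matrix {ι : Type*} {l : Filter ι} {X : ι → D.Mat} {L : D.Mat} :
    Tendsto X l (𝓝 L) ↔ ∀ i j, Tendsto (fun k => X k i j) l (𝓝 (L i j)) := by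
  exact tendsto_pi_nhds.trans (forall_congr' fun i => tendsto_pi_nhds)

lemma tendsto_rateMap {ι : Type*} {l : Filter ι} {A₀ A₁ X : ι → D.Mat} {B₀ B₁ A₂ L : D.Mat}
    (h0 : Tendsto A₀ l (𝓝 B₀)) (h1 : Tendsto A₁ l (𝓝 B₁)) (hX : Tendsto X l (𝓝 L)) :
    Tendsto (fun k => rateMap (A₀ k) (A₁ k) A₂ (X k)) l (𝓝 (rateMap B₀ B₁ A₂ L)) :=
  (h0.add (hX.mul h1)).add ((hX.pow 2).mul_const A₂)

lemma IsLoad.rateMatrix_fixed {φ : D.Vec} (h : D.IsLoad φ) :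
    D.rateMatrix φ = rateMap (D.A0 φ) (D.A1 φ) D.A2 (D.rateMatrix φ) := by
  have h1 : Tendsto (fun m => D.rIter φ m) atTop (𝓝 (D.rateMatrix φ)) :=
    tendsto_matrix.2 h.tendsto_rIter
  exact tendsto_nhds_unique ((tendsto_add_atTop_iff_nat 1).2 h1)
    (tendsto_rateMap tendsto_const_nhds tendsto_const_nhds h1)

lemma IsLoad.certified_rateMatrix {φ : D.Vec} (h : D.IsLoad φ) : Certified φ (D.rateMatrix φ) :=
  fun y ζ θ hc hθ => LeftBound.of_tendsto
    (Eventually.of_forall fun m => h.certified_rIter m y ζ θ hc hθ) h.tendsto_rIter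

lemma IsLoad.isRMatrix {φ : D.Vec} (h : D.IsLoad φ) : D.IsRMatrix φ (D.rateMatrix φ) := by
  refine ⟨(h.certified_rateMatrix _ _ _ h.certificate_nu le_rfl).nonneg, h.rateMatrix_fixed,
    fun R' h0 h1 i j => le_of_tendsto' (h.tendsto_rIter i j) fun m => ?_⟩
  induction m generalizing i j with
  | zero => exact h0 i j
  | succ m ih =>
    rw [h1]
    exact h.blocks.rateMap_mono (h.rIter_nonneg m) ih i j

lemma IsLoad.eq_rateMatrix {φ : D.Vec} (h : D.IsLoad φ) {R : D.Mat} (hR : D.IsRMatrix φ R) :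
    R = D.rateMatrix φ := by
  have h1 := h.isRMatrix
  funext i j
  exact le_antisymm (hR.2.2 _ h1.1 h1.2.1 i j) (h1.2.2 _ hR.1 hR.2.1 i j)

/-! ### One pass of the algorithm -/

section Pass

variable {φ y : D.Vec} {ζ θ : ℝ} {X : D.Mat} (hφ : D.IsLoad φ)
  (hc : Certificate (D.A0 φ) (D.A1 φ) D.A2 y ζ θ) (hζ : ζ < 1) (hθ : θ < 1)
  (hX : LeftBound y ζ X)

/-- Phase occupancies per unit of idle probability. -/
noncomputable def ratio (φ : D.Vec) (X : D.Mat) : D.Vec :=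
  (D.C ᵥ* (D.bdry φ X)⁻¹) ᵥ* (1 - X)⁻¹

lemma occ_eq (φ : D.Vec) (X : D.Mat) : D.occ φ X = D.idle φ X • ratio φ X := by
  rw [occ, level1, ratio, smul_vecMul]

lemma idle_eq (φ : D.Vec) (X : D.Mat) : D.idle φ X = (1 + ∑ j, ratio φ X j)⁻¹ := by
  rw [idle, Matrix.mul_inv_rev, dotProduct_mulVec, ← vecMul_vecMul, dotProduct_one]
  rfl

include hφ hc hζ hθ hX

lemma ratio_nonneg (j) : 0 ≤ ratio φ X j :=
  vecMul_nonneg (vecMul_nonneg D.C_nonneg (boundary_inv_nonneg hφ.blocks hc hθ hX))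
    (hX.inv_nonneg hc.pos hc.rate_pos.le hζ) j

lemma idle_pos : 0 < D.idle φ X := by
  rw [idle_eq]
  have := Finset.sum_nonneg fun j (_ : j ∈ Finset.univ) => ratio_nonneg hφ hc hζ hθ hX j
  positivity

lemma idle_eq_one_sub : D.idle φ X = 1 - ∑ j, D.occ φ X j := by
  have h := Finset.sum_nonneg fun j (_ : j ∈ Finset.univ) => ratio_nonneg hφ hc hζ hθ hX j
  simp only [occ_eq, Pi.smul_apply, smul_eq_mul, ← Finset.mul_sum]
  rw [idle_eq]
  field_simp
  ring

lemma isLoad_occ : D.IsLoad (D.occ φ X) := by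
  have h1 := idle_pos hφ hc hζ hθ hX
  have h2 := idle_eq_one_sub hφ hc hζ hθ hX
  refine ⟨fun j => ?_, by linarith⟩
  rw [occ_eq]
  exact mul_nonneg h1.le (ratio_nonneg hφ hc hζ hθ hX j)

lemma level1_nonneg (j) : 0 ≤ D.level1 φ X j :=
  mul_nonneg (idle_pos hφ hc hζ hθ hX).le
    (vecMul_nonneg D.C_nonneg (boundary_inv_nonneg hφ.blocks hc hθ hX) j)

omit hφ hθ in
lemma occ_vecMul : D.occ φ X ᵥ* (1 - X) = D.level1 φ X := by
  rw [occ, vecMul_vecMul, nonsing_inv_mul _ (hX.isUnit_det hc.pos hc.rate_pos.le hζ), vecMul_one]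

omit hζ in
lemma level1_vecMul : D.level1 φ X ᵥ* (1 - D.A1 φ - X * D.A2) = D.idle φ X • D.C := by
  rw [level1, smul_vecMul, vecMul_vecMul, bdry,
    nonsing_inv_mul _ (isUnit_det_boundary hφ.blocks hc hθ hX), vecMul_one]

end Pass

/-- A nonnegative solution `L` of the matrix equation and a vector `w` of phase occupancies that
solves the boundary equation yield balanced level vectors `w (I - L) L ^ l`, whatever the spectral
radius of `L`. -/
lemma balanced_of_fixed {φ w : D.Vec} {x₀ : ℝ} {L : D.Mat} (hφ : D.IsLoad φ)
    (hfix : L = rateMap (D.A0 φ) (D.A1 φ) D.A2 L)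
    (hb : (w ᵥ* (1 - L)) ᵥ* (1 - D.A1 φ - L * D.A2) = x₀ • D.C) :
    Balanced φ x₀ (fun l => (w ᵥ* (1 - L)) ᵥ* L ^ l) := by
  generalize hy : w ᵥ* (1 - L) = y at hb ⊢
  have hb' : y = x₀ • D.C + y ᵥ* D.A1 φ + (y ᵥ* L) ᵥ* D.A2 := by
    rw [vecMul_sub, vecMul_sub, vecMul_one, ← vecMul_vecMul] at hb
    linear_combination hb
  refine ⟨?_, ?_, fun m => ?_⟩
  · have hwL : w ᵥ* L = w - y := by rw [← hy, vecMul_sub, vecMul_one]; abel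
    have h1 : w ᵥ* L = w ᵥ* D.A0 φ + (w ᵥ* L) ᵥ* D.A1 φ + ((w ᵥ* L) ᵥ* L) ᵥ* D.A2 := by
      conv_lhs => rw [hfix]
      simp only [rateMap, vecMul_add, vecMul_vecMul, sq]
    rw [hwL, sub_vecMul L, hwL] at h1
    have h2 : w + y ᵥ* D.A2 = w ᵥ* (D.A0 φ + D.A1 φ + D.A2) + x₀ • D.C := by
      simp only [vecMul_add, sub_vecMul] at h1 ⊢
      linear_combination h1 + hb'
    have h3 := congrArg (fun v => v ⬝ᵥ (1 : D.Vec)) h2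
    simp only [add_dotProduct, smul_dotProduct, ← dotProduct_mulVec, hφ.blocks.row,
      C_dotProduct_one, smul_eq_mul] at h3
    rw [pow_zero, vecMul_one]
    linarith
  · simpa using hb'
  · have h1 : ∀ k, y ᵥ* L ^ (m + k) = (y ᵥ* L ^ m) ᵥ* L ^ k := fun k => by
      rw [vecMul_vecMul, pow_add]
    have h2 := congrArg (fun B => (y ᵥ* L ^ m) ᵥ* B) hfix
    simp only [rateMap, vecMul_add, ← vecMul_vecMul] at h2
    simpa only [h1, pow_one] using h2

section Stationary

variable {φ y : D.Vec} {ζ θ : ℝ} (hφ : D.IsLoad φ)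
  (hc : Certificate (D.A0 φ) (D.A1 φ) D.A2 y ζ θ) (hζ : ζ < 1) (hθ : θ < 1)
include hφ hc hζ hθ

lemma hasSum_level1 (j) :
    HasSum (fun l : ℕ => (D.level1 φ (D.rateMatrix φ) ᵥ* D.rateMatrix φ ^ l) j)
      (D.occ φ (D.rateMatrix φ) j) :=
  (hφ.certified_rateMatrix _ _ _ hc hθ.le).hasSum_vecMul_pow hc.pos hc.rate_pos.le hζ _ j

/-- Sufficiency of the stability condition: the matrix-geometric distribution is stationary. -/
lemma isStationary_geometric :
    D.IsStationary φ (fun s => s.elim (D.idle φ (D.rateMatrix φ))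
      fun q => (D.level1 φ (D.rateMatrix φ) ᵥ* D.rateMatrix φ ^ q.1) q.2) := by
  have hX := hφ.certified_rateMatrix _ _ _ hc hθ.le
  have hb := balanced_of_fixed (w := D.occ φ (D.rateMatrix φ)) (x₀ := D.idle φ (D.rateMatrix φ))
    hφ hφ.rateMatrix_fixed (by
      rw [occ_vecMul hc hζ hX, level1_vecMul hφ hc hθ hX])
  rw [occ_vecMul hc hζ hX] at hb
  refine hb.isStationary (idle_pos hφ hc hζ hθ hX).le (fun l j => ?_)
    (hasSum_level1 hφ hc hζ hθ) ?_
  · exact vecMul_nonneg (level1_nonneg hφ hc hζ hθ hX) (hX.pow hc.rate_pos.le l).nonneg j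
  · rw [idle_eq_one_sub hφ hc hζ hθ hX]
    ring

/-- The matrix-geometric distribution is the only stationary one: by `geometric_of_balance` a
stationary distribution is determined by its idle probability, which the total mass fixes. -/
lemma IsStationary.eq_geometric {x : D.State → ℝ} (hx : D.IsStationary φ x) :
    x = fun s => s.elim (D.idle φ (D.rateMatrix φ))
      fun q => (D.level1 φ (D.rateMatrix φ) ᵥ* D.rateMatrix φ ^ q.1) q.2 := by
  have hX := hφ.certified_rateMatrix _ _ _ hc hθ.le
  have hb := hx.balanced
  obtain ⟨h0, hs⟩ := geometric_of_balance hφ.blocks hc hθ hX hζ hφ.rateMatrix_fixed hb.first hb.step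
    fun j => (hx.summable_level j).tendsto_atTop_zero
  have hv : ∀ j, HasSum (fun l : ℕ => x (some (l, j))) ((x none • ratio φ (D.rateMatrix φ)) j) := by
    intro j
    have h1 := hX.hasSum_vecMul_pow hc.pos hc.rate_pos.le hζ
      ((x none • D.C) ᵥ* (1 - D.A1 φ - D.rateMatrix φ * D.A2)⁻¹) j
    rw [← h0] at h1
    have h2 : x none • ratio φ (D.rateMatrix φ) =
        (fun j => x (some (0, j))) ᵥ* (1 - D.rateMatrix φ)⁻¹ := by
      rw [h0, smul_vecMul, smul_vecMul]
      rfl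
    rw [h2]
    exact h1.congr_fun fun l => congrFun (hs l) j
  have hm := hx.none_add_sum hv
  have hx0 : x none = D.idle φ (D.rateMatrix φ) := by
    simp only [Pi.smul_apply, smul_eq_mul, ← Finset.mul_sum] at hm
    rw [idle_eq]
    exact eq_inv_of_mul_eq_one_left (by linarith)
  funext s
  match s with
  | none => exact hx0
  | some (l, j) =>
    refine (congrFun (hs l) j).trans ?_
    dsimp only [Option.elim]
    rw [h0, hx0, smul_vecMul]
    rfl

end Stationary

lemma IsLoad.stable_iff_exists_stationary {φ : D.Vec} (hφ : D.IsLoad φ) :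
    D.Stable φ ↔ ∃ x, D.IsStationary φ x := by
  constructor
  · intro hs
    obtain ⟨y, ζ, θ, hc, hζ, hθ⟩ := hφ.exists_certificate hs
    exact ⟨_, isStationary_geometric hφ hc hζ hθ⟩
  · rintro ⟨x, hx⟩
    exact hx.stable hφ

lemma IsLoad.exactStep_iff {φ φ' : D.Vec} (hφ : D.IsLoad φ) :
    D.ExactStep φ φ' ↔ D.Stable φ ∧ φ' = D.occ φ (D.rateMatrix φ) := by
  constructor
  · rintro ⟨hs, R, hR, rfl⟩
    rw [hφ.eq_rateMatrix hR]
    exact ⟨hs, rfl⟩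
  · rintro ⟨hs, rfl⟩
    exact ⟨hs, _, hφ.isRMatrix, rfl⟩

lemma IsLoad.isLoad_exact {φ : D.Vec} (hφ : D.IsLoad φ) (hs : D.Stable φ) :
    D.IsLoad (D.occ φ (D.rateMatrix φ)) := by
  obtain ⟨y, ζ, θ, hc, hζ, hθ⟩ := hφ.exists_certificate hs
  exact isLoad_occ hφ hc hζ hθ (hφ.certified_rateMatrix _ _ _ hc hθ.le)

lemma IsLoad.isSteadyState_iff {x₀ : ℝ} {φ : D.Vec} (hφ : D.IsLoad φ) :
    D.IsSteadyState x₀ φ ↔ D.ExactStep φ φ ∧ x₀ = 1 - ∑ j, φ j := by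
  rw [hφ.exactStep_iff]
  constructor
  · rintro ⟨x, hx, rfl, hs⟩
    have hst := hx.stable hφ
    obtain ⟨y, ζ, θ, hc, hζ, hθ⟩ := hφ.exists_certificate hst
    refine ⟨⟨hst, funext fun j => (hs j).unique ?_⟩, ?_⟩
    · rw [hx.eq_geometric hφ hc hζ hθ]
      exact hasSum_level1 hφ hc hζ hθ j
    · rw [← hx.none_add_sum hs]
      ring
  · rintro ⟨⟨hst, he⟩, rfl⟩
    obtain ⟨y, ζ, θ, hc, hζ, hθ⟩ := hφ.exists_certificate hst
    refine ⟨_, isStationary_geometric hφ hc hζ hθ, ?_, fun j => ?_⟩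
    · have h := idle_eq_one_sub hφ hc hζ hθ (hφ.certified_rateMatrix _ _ _ hc hθ.le)
      rwa [← he] at h
    · have h := hasSum_level1 hφ hc hζ hθ j
      rwa [← he] at h

/-! ### Dependence on the load -/

section Limits

variable {ι : Type*} {l : Filter ι} {φ : ι → D.Vec} {φ₀ : D.Vec}

lemma isLoad_of_tendsto [l.NeBot] (hφ : ∀ᶠ k in l, D.IsLoad (φ k)) (h : Tendsto φ l (𝓝 φ₀)) :
    D.IsLoad φ₀ := by
  have hj := tendsto_pi_nhds.1 h
  exact ⟨fun j => ge_of_tendsto (hj j) (hφ.mono fun _ hk => hk.1 j),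
    le_of_tendsto (tendsto_finsetSum _ fun j _ => hj j) (hφ.mono fun _ hk => hk.2)⟩

lemma tendsto_vecMul {v : ι → D.Vec} {v₀ : D.Vec} {B : ι → D.Mat} {B₀ : D.Mat}
    (hv : Tendsto v l (𝓝 v₀)) (hB : Tendsto B l (𝓝 B₀)) :
    Tendsto (fun k => v k ᵥ* B k) l (𝓝 (v₀ ᵥ* B₀)) :=
  tendsto_pi_nhds.2 fun j => tendsto_finsetSum Finset.univ fun i _ =>
    (tendsto_pi_nhds.1 hv i).mul (tendsto_matrix.1 hB i j)

lemma tendsto_matrix_inv {B : ι → D.Mat} {B₀ : D.Mat} (hB : Tendsto B l (𝓝 B₀))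
    (hu : IsUnit B₀.det) : Tendsto (fun k => (B k)⁻¹) l (𝓝 B₀⁻¹) := by
  refine (continuousAt_matrix_inv B₀ ?_).tendsto.comp hB
  rw [Ring.inverse_eq_inv']
  exact continuousAt_inv₀ hu.ne_zero

variable (hφ : ∀ᶠ k in l, D.IsLoad (φ k)) (h0 : D.IsLoad φ₀) (h : Tendsto φ l (𝓝 φ₀))
include hφ h0 h

lemma tendsto_grant : Tendsto (fun k => D.grant (φ k)) l (𝓝 (D.grant φ₀)) :=
  (D.continuousOn_grant φ₀ h0).tendsto.comp (tendsto_nhdsWithin_iff.2 ⟨h, hφ⟩)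

lemma tendsto_S : Tendsto (fun k => D.S (φ k)) l (𝓝 (D.S φ₀)) := by
  have hg := tendsto_grant hφ h0 h
  refine tendsto_matrix.2 fun i j => ?_
  simp only [S_apply]
  refine Tendsto.add ?_ tendsto_const_nhds
  split_ifs
  · exact hg.const_sub 1
  · exact hg
  · exact tendsto_const_nhds
  · exact tendsto_const_nhds

lemma tendsto_A0 : Tendsto (fun k => D.A0 (φ k)) l (𝓝 (D.A0 φ₀)) :=
  (tendsto_S hφ h0 h).const_smul D.a

lemma tendsto_A1 : Tendsto (fun k => D.A1 (φ k)) l (𝓝 (D.A1 φ₀)) :=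
  ((tendsto_S hφ h0 h).const_smul (1 - D.a)).const_add _

lemma tendsto_nu (j) : Tendsto (fun k => D.nu (φ k) j) l (𝓝 (D.nu φ₀ j)) := by
  have hg := tendsto_grant hφ h0 h
  have hpos : 1 + D.N * D.grant φ₀ ≠ 0 := by
    have := (D.grant_mem h0).1
    positivity
  have h1 : Tendsto (fun k => 1 / (1 + D.N * D.grant (φ k))) l (𝓝 (1 / (1 + D.N * D.grant φ₀))) :=
    tendsto_const_nhds.div ((hg.const_mul _).const_add 1) hpos
  simp only [nu_eq]
  split_ifs
  · exact h1
  · exact h1.mul hg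

lemma eventually_stable (hs : D.Stable φ₀) : ∀ᶠ k in l, D.Stable (φ k) := by
  have hg := tendsto_grant hφ h0 h
  have h1 := ((hg.const_mul (D.N : ℝ)).const_add 1).const_mul D.a
  have h2 := (hg.const_mul (D.N : ℝ)).mul_const D.pTx
  filter_upwards [hφ, h1.eventually_lt h2 (h0.stable_iff.1 hs)] with k hk hlt
  exact hk.stable_iff.2 hlt

lemma eventually_certificate {y : D.Vec} {ζ θ θ' : ℝ}
    (hc : Certificate (D.A0 φ₀) (D.A1 φ₀) D.A2 y ζ θ) (hθ : θ < θ') :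
    ∀ᶠ k in l, Certificate (D.A0 (φ k)) (D.A1 (φ k)) D.A2 y ζ θ' := by
  have hev : ∀ j, ∀ᶠ k in l, (y ᵥ* D.A0 (φ k)) j + ζ * (y ᵥ* D.A1 (φ k)) j +
      ζ ^ 2 * (y ᵥ* D.A2) j < θ' * ζ * y j := by
    intro j
    have h1 := tendsto_pi_nhds.1 (tendsto_vecMul (tendsto_const_nhds (x := y))
      (tendsto_A0 hφ h0 h)) j
    have h2 := tendsto_pi_nhds.1 (tendsto_vecMul (tendsto_const_nhds (x := y))
      (tendsto_A1 hφ h0 h)) j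
    refine ((h1.add (h2.const_mul ζ)).add_const _).eventually_lt_const ((hc.le j).trans_lt ?_)
    have := hc.rate_pos
    have := hc.pos j
    gcongr
  filter_upwards [eventually_all.2 hev] with k hk
  exact ⟨hc.pos, hc.rate_pos, hc.nonneg.trans hθ.le, fun j => (hk j).le⟩

lemma tendsto_occ {y : D.Vec} {ζ θ : ℝ} (hc : Certificate (D.A0 φ₀) (D.A1 φ₀) D.A2 y ζ θ)
    (hζ : ζ < 1) (hθ : θ < 1) {X : ι → D.Mat} {L : D.Mat} (hL : LeftBound y ζ L)
    (hX : Tendsto X l (𝓝 L)) : Tendsto (fun k => D.occ (φ k) (X k)) l (𝓝 (D.occ φ₀ L)) := by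
  have hb : Tendsto (fun k => D.bdry (φ k) (X k)) l (𝓝 (D.bdry φ₀ L)) :=
    ((tendsto_A1 hφ h0 h).const_sub 1).sub (hX.mul_const _)
  have hr : Tendsto (fun k => ratio (φ k) (X k)) l (𝓝 (ratio φ₀ L)) :=
    tendsto_vecMul (tendsto_vecMul tendsto_const_nhds
      (tendsto_matrix_inv hb (isUnit_det_boundary h0.blocks hc hθ hL)))
      (tendsto_matrix_inv (hX.const_sub 1) (hL.isUnit_det hc.pos hc.rate_pos.le hζ))
  have hne : 1 + ∑ j, ratio φ₀ L j ≠ 0 := by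
    have := Finset.sum_nonneg fun j (_ : j ∈ Finset.univ) => ratio_nonneg h0 hc hζ hθ hL j
    positivity
  simp only [occ_eq, idle_eq]
  exact (((tendsto_finsetSum _ fun j _ => tendsto_pi_nhds.1 hr j).const_add 1).inv₀ hne).smul hr

end Limits

section Compactness

variable {ι : Type*} {φ₀ : D.Vec}

/-- Approximate solutions of the matrix equation at loads `φ k → φ₀` are bounded by means of the
vectors `ν`, and their limits solve the equation at `φ₀`. -/
lemma exists_fixed_limit (g : Ultrafilter ι) {φ : ι → D.Vec} {X : ι → D.Mat}
    (hφ : ∀ᶠ k in g, D.IsLoad (φ k)) (h0 : D.IsLoad φ₀) (h : Tendsto φ g (𝓝 φ₀))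
    (hX : ∀ᶠ k in g, Certified (φ k) (X k))
    (hd : ∀ i j, Tendsto (fun k =>
      rateMap (D.A0 (φ k)) (D.A1 (φ k)) D.A2 (X k) i j - X k i j) g (𝓝 0)) :
    ∃ L : D.Mat, Tendsto X g (𝓝 L) ∧ L = rateMap (D.A0 φ₀) (D.A1 φ₀) D.A2 L ∧
      ∀ i j, 0 ≤ L i j := by
  have hlim : ∀ i j, ∃ c, 0 ≤ c ∧ Tendsto (fun k => X k i j) g (𝓝 c) := by
    intro i j
    have hB := ((tendsto_nu hφ h0 h j).const_mul 1).div (tendsto_nu hφ h0 h i) (h0.nu_pos i).ne'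
    have hev : ∀ᶠ k in g, X k i j ∈ Set.Icc 0 (1 * D.nu φ₀ j / D.nu φ₀ i + 1) := by
      filter_upwards [hφ, hX, hB.eventually_lt_const (lt_add_one _)] with k h1 h2 h3
      have h4 := h2 _ _ _ h1.certificate_nu le_rfl
      exact ⟨h4.nonneg i j, (h4.entry_le h1.nu_pos i j).trans h3.le⟩
    obtain ⟨c, hc, hle⟩ := isCompact_Icc.ultrafilter_le_nhds (g.map fun k => X k i j)
      (le_principal_iff.2 hev)
    exact ⟨c, hc.1, hle⟩
  choose L hL hLX using hlim
  have hXL : Tendsto X g (𝓝 L) := tendsto_matrix.2 hLX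
  refine ⟨L, hXL, ?_, hL⟩
  have h1 := tendsto_matrix.1
    (tendsto_rateMap (A₂ := D.A2) (tendsto_A0 hφ h0 h) (tendsto_A1 hφ h0 h) hXL)
  funext i j
  exact (sub_eq_zero.1 (tendsto_nhds_unique ((h1 i j).sub (hLX i j)) (hd i j))).symm

/-- Approximate solutions of the matrix equation converge to the rate matrix at a stable limit. -/
lemma tendsto_rateMatrix {l : Filter ι} {φ : ι → D.Vec} {X : ι → D.Mat}
    (hφ : ∀ᶠ k in l, D.IsLoad (φ k)) (h0 : D.IsLoad φ₀) (hs : D.Stable φ₀)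
    (h : Tendsto φ l (𝓝 φ₀)) (hX : ∀ᶠ k in l, Certified (φ k) (X k))
    (hd : ∀ i j, Tendsto (fun k =>
      rateMap (D.A0 (φ k)) (D.A1 (φ k)) D.A2 (X k) i j - X k i j) l (𝓝 0)) :
    Tendsto X l (𝓝 (D.rateMatrix φ₀)) := by
  obtain ⟨y, ζ, θ, hc, hζ, hθ⟩ := h0.exists_certificate hs
  refine tendsto_iff_ultrafilter _ _ _ |>.2 fun g hg => ?_
  obtain ⟨L, hXL, hfix, -⟩ := exists_fixed_limit g (hφ.filter_mono hg) h0 (h.mono_left hg)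
    (hX.filter_mono hg) fun i j => (hd i j).mono_left hg
  obtain ⟨θ', hθ', hθ1⟩ := exists_between hθ
  have hev : ∀ᶠ k in (g : Filter ι), LeftBound y ζ (X k) := by
    filter_upwards [(eventually_certificate hφ h0 h hc hθ').filter_mono hg, hX.filter_mono hg]
      with k h1 h2
    exact h2 _ _ _ h1 hθ1.le
  have hL : LeftBound y ζ L := LeftBound.of_tendsto hev (tendsto_matrix.1 hXL)
  rwa [← rateMap_fixed_unique h0.blocks hc hθ (h0.certified_rateMatrix _ _ _ hc hθ.le) hζ
    h0.rateMatrix_fixed hL hfix]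

/-- If occupancies computed from approximate solutions tend to a vector of total mass below one,
the chain at the limit has a stationary distribution, built from the limiting data; so the limit is
stable. -/
lemma stable_of_tendsto (g : Ultrafilter ι) {φ : ι → D.Vec} {X : ι → D.Mat}
    (hφ : ∀ᶠ k in g, D.IsLoad (φ k) ∧ D.Stable (φ k)) (h0 : D.IsLoad φ₀) (h : Tendsto φ g (𝓝 φ₀))
    (hX : ∀ᶠ k in g, Certified (φ k) (X k)) {L : D.Mat} (hXL : Tendsto X g (𝓝 L))
    (hL : ∀ i j, 0 ≤ L i j) (hfix : L = rateMap (D.A0 φ₀) (D.A1 φ₀) D.A2 L)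
    (hocc : Tendsto (fun k => D.occ (φ k) (X k)) g (𝓝 φ₀)) (hlt : ∑ j, φ₀ j < 1) :
    D.Stable φ₀ := by
  have hφ' := hφ.mono fun _ hk => hk.1
  have hpass : ∀ᶠ k in (g : Filter ι), (∀ j, 0 ≤ D.level1 (φ k) (X k) j) ∧
      D.occ (φ k) (X k) ᵥ* (1 - X k) = D.level1 (φ k) (X k) ∧
      D.level1 (φ k) (X k) ᵥ* (1 - D.A1 (φ k) - X k * D.A2)
        = (1 - ∑ j, D.occ (φ k) (X k) j) • D.C := by
    filter_upwards [hφ, hX] with k hk hXk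
    obtain ⟨y, ζ, θ, hc, hζ, hθ⟩ := hk.1.exists_certificate hk.2
    have hb := hXk _ _ _ hc hθ.le
    exact ⟨level1_nonneg hk.1 hc hζ hθ hb, occ_vecMul hc hζ hb, by
      rw [level1_vecMul hk.1 hc hθ hb, idle_eq_one_sub hk.1 hc hζ hθ hb]⟩
  set y := φ₀ ᵥ* (1 - L) with hy
  have hlev : Tendsto (fun k => D.level1 (φ k) (X k)) g (𝓝 y) :=
    (tendsto_vecMul hocc (hXL.const_sub 1)).congr' (hpass.mono fun k hk => hk.2.1)
  have hy0 : ∀ j, 0 ≤ y j := fun j =>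
    ge_of_tendsto (tendsto_pi_nhds.1 hlev j) (hpass.mono fun k hk => hk.1 j)
  have hidle : Tendsto (fun k => (1 - ∑ j, D.occ (φ k) (X k) j) • D.C) g
      (𝓝 ((1 - ∑ j, φ₀ j) • D.C)) :=
    ((tendsto_finsetSum _ fun j _ => tendsto_pi_nhds.1 hocc j).const_sub 1).smul_const _
  have hbd : y ᵥ* (1 - D.A1 φ₀ - L * D.A2) = (1 - ∑ j, φ₀ j) • D.C :=
    tendsto_nhds_unique ((tendsto_vecMul hlev (((tendsto_A1 hφ' h0 h).const_sub 1).sub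
      (hXL.mul_const _))).congr' (hpass.mono fun k hk => hk.2.2)) hidle
  have hbal := balanced_of_fixed h0 hfix hbd
  rw [← hy] at hbal
  have hpow : ∀ l, ∀ i j, 0 ≤ (L ^ l) i j := by
    intro l
    induction l with
    | zero => intro i j; rw [pow_zero, one_apply]; split_ifs <;> norm_num
    | succ l ih => rw [pow_succ]; exact mul_entry_nonneg ih hL
  have hY : ∀ l j, 0 ≤ (y ᵥ* L ^ l) j := fun l => vecMul_nonneg hy0 (hpow l)
  -- telescoping: the partial sums are `φ₀ (I - L ^ m)`
  have hpartial : ∀ m j, ∑ l ∈ Finset.range m, (y ᵥ* L ^ l) j = φ₀ j - (φ₀ ᵥ* L ^ m) j := by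
    intro m j
    induction m with
    | zero => simp
    | succ m ih =>
      rw [Finset.sum_range_succ, ih, hy, vecMul_vecMul, sub_mul, one_mul, ← pow_succ', vecMul_sub,
        Pi.sub_apply]
      ring
  have hsum : ∀ j, Summable fun l => (y ᵥ* L ^ l) j := fun j =>
    summable_of_sum_range_le (hY · j) (c := φ₀ j) fun m => by
      rw [hpartial]
      have := vecMul_nonneg h0.1 (hpow m) j
      linarith
  have hv := fun j => (hsum j).hasSum
  set T : ℝ := 1 - ∑ j, φ₀ j + ∑ j, ∑' l, (y ᵥ* L ^ l) j with hT
  have hTpos : 0 < T := add_pos_of_pos_of_nonneg (sub_pos.2 hlt)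
    (Finset.sum_nonneg fun j _ => tsum_nonneg fun l => hY l j)
  refine ((hbal.smul T⁻¹).isStationary (mul_nonneg (inv_nonneg.2 hTpos.le) (sub_nonneg.2 hlt.le))
    (fun l j => mul_nonneg (inv_nonneg.2 hTpos.le) (hY l j)) (fun j => (hv j).mul_left T⁻¹)
    ?_).stable h0
  rw [← Finset.mul_sum, ← mul_add, ← hT, inv_mul_cancel₀ hTpos.ne']

end Compactness

/-! ### Accuracy of one pass -/

lemma IsLoad.exists_rStops {φ : D.Vec} (h : D.IsLoad φ) {δ : ℝ} (hδ : 0 < δ) :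
    ∃ m, D.RStops φ δ m := by
  have hev : ∀ᶠ m in atTop, ∀ i j, |D.rIter φ (m + 1) i j - D.rIter φ m i j| < δ := by
    refine eventually_all.2 fun i => eventually_all.2 fun j => ?_
    have h1 := h.tendsto_rIter i j
    have h2 := (((tendsto_add_atTop_iff_nat 1).2 h1).sub h1).abs
    rw [sub_self, abs_zero] at h2
    exact h2.eventually_lt_const hδ
  exact hev.exists

lemma IsLoad.abs_rAlg_lt {φ : D.Vec} (h : D.IsLoad φ) {δ : ℝ} (hδ : 0 < δ) (i j) :
    |rateMap (D.A0 φ) (D.A1 φ) D.A2 (D.rIter φ (sInf {m | D.RStops φ δ m})) i j -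
      D.rIter φ (sInf {m | D.RStops φ δ m}) i j| < δ :=
  Nat.sInf_mem (s := {m | D.RStops φ δ m}) (h.exists_rStops hδ) i j

lemma IsLoad.certified_rAlg {φ : D.Vec} (h : D.IsLoad φ) (δ : ℝ) : Certified φ (D.rAlg φ δ) :=
  h.certified_rIter _

lemma IsLoad.step_spec {φ : D.Vec} (h : D.IsLoad φ) (hs : D.Stable φ) (δ : ℝ) :
    D.IsLoad (D.step δ φ) ∧ 0 < 1 - ∑ j, D.step δ φ j := by
  obtain ⟨y, ζ, θ, hc, hζ, hθ⟩ := h.exists_certificate hs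
  have hX := h.certified_rAlg δ _ _ _ hc hθ.le
  refine ⟨isLoad_occ h hc hζ hθ hX, ?_⟩
  rw [step, ← idle_eq_one_sub h hc hζ hθ hX]
  exact idle_pos h hc hζ hθ hX

section Limits

variable {ι : Type*} {l : Filter ι} {φ : ι → D.Vec} {φ₀ : D.Vec} {δ : ι → ℝ}

lemma tendsto_rIter_defect (hφ : ∀ᶠ k in l, D.IsLoad (φ k)) (hδ : ∀ᶠ k in l, 0 < δ k)
    (hδ0 : Tendsto δ l (𝓝 0)) (i j) :
    Tendsto (fun k => rateMap (D.A0 (φ k)) (D.A1 (φ k)) D.A2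
        (D.rIter (φ k) (sInf {m | D.RStops (φ k) (δ k) m})) i j -
      D.rIter (φ k) (sInf {m | D.RStops (φ k) (δ k) m}) i j) l (𝓝 0) := by
  refine squeeze_zero_norm' ?_ hδ0
  filter_upwards [hφ, hδ] with k h1 h2
  exact (h1.abs_rAlg_lt h2 i j).le

variable (hφ : ∀ᶠ k in l, D.IsLoad (φ k)) (h0 : D.IsLoad φ₀) (h : Tendsto φ l (𝓝 φ₀))
  (hδ : ∀ᶠ k in l, 0 < δ k) (hδ0 : Tendsto δ l (𝓝 0)) (hs : D.Stable φ₀)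
include hφ h0 h hδ hδ0 hs

lemma tendsto_rAlg : Tendsto (fun k => D.rAlg (φ k) (δ k)) l (𝓝 (D.rateMatrix φ₀)) := by
  have hd := tendsto_rIter_defect hφ hδ hδ0
  have h1 := tendsto_matrix.1 (tendsto_rateMatrix hφ h0 hs h
    (hφ.mono fun k hk => hk.certified_rIter (sInf {m | D.RStops (φ k) (δ k) m})) hd)
  refine tendsto_matrix.2 fun i j => ?_
  have h2 := (hd i j).add (h1 i j)
  rw [zero_add] at h2
  exact h2.congr fun k => sub_add_cancel _ _

lemma tendsto_step :
    Tendsto (fun k => D.step (δ k) (φ k)) l (𝓝 (D.occ φ₀ (D.rateMatrix φ₀))) := by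
  obtain ⟨y, ζ, θ, hc, hζ, hθ⟩ := h0.exists_certificate hs
  exact tendsto_occ hφ h0 h hc hζ hθ (h0.certified_rateMatrix _ _ _ hc hθ.le)
    (tendsto_rAlg hφ h0 h hδ hδ0 hs)

end Limits

lemma tendsto_exact {ι : Type*} {l : Filter ι} {φ : ι → D.Vec} {φ₀ : D.Vec}
    (hφ : ∀ᶠ k in l, D.IsLoad (φ k)) (h0 : D.IsLoad φ₀) (h : Tendsto φ l (𝓝 φ₀))
    (hs : D.Stable φ₀) :
    Tendsto (fun k => D.occ (φ k) (D.rateMatrix (φ k))) l (𝓝 (D.occ φ₀ (D.rateMatrix φ₀))) := by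
  obtain ⟨y, ζ, θ, hc, hζ, hθ⟩ := h0.exists_certificate hs
  refine tendsto_occ hφ h0 h hc hζ hθ (h0.certified_rateMatrix _ _ _ hc hθ.le)
    (tendsto_rateMatrix hφ h0 hs h (hφ.mono fun k hk => hk.certified_rateMatrix) fun i j => ?_)
  exact tendsto_const_nhds.congr' (hφ.mono fun k hk =>
    (sub_eq_zero.2 (congrFun (congrFun hk.rateMatrix_fixed i) j).symm).symm)

/-- A limit of occupancies returned by ever more accurate passes is stable or leaves no idle time. -/
lemma stable_or_sum_eq_one {ι : Type*} {l : Filter ι} [l.NeBot] {φ : ι → D.Vec} {φ₀ : D.Vec}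
    {Z X : ι → D.Mat} (hφ : ∀ᶠ k in l, D.IsLoad (φ k) ∧ D.Stable (φ k)) (h : Tendsto φ l (𝓝 φ₀))
    (hZ : ∀ᶠ k in l, Certified (φ k) (Z k))
    (hX : ∀ᶠ k in l, X k = rateMap (D.A0 (φ k)) (D.A1 (φ k)) D.A2 (Z k))
    (hd : ∀ i j, Tendsto (fun k =>
      rateMap (D.A0 (φ k)) (D.A1 (φ k)) D.A2 (Z k) i j - Z k i j) l (𝓝 0))
    (hocc : Tendsto (fun k => D.occ (φ k) (X k)) l (𝓝 φ₀)) :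
    D.Stable φ₀ ∨ ∑ j, φ₀ j = 1 := by
  have hφ' := hφ.mono fun _ hk => hk.1
  have h0 := isLoad_of_tendsto hφ' h
  by_contra! hcon
  have hlt : ∑ j, φ₀ j < 1 := lt_of_le_of_ne h0.2 hcon.2
  have hg : (Ultrafilter.of l : Filter ι) ≤ l := Ultrafilter.of_le l
  obtain ⟨L, hZL, hfix, hL⟩ := exists_fixed_limit (Ultrafilter.of l) (hφ'.filter_mono hg) h0
    (h.mono_left hg) (hZ.filter_mono hg) fun i j => (hd i j).mono_left hg
  refine hcon.1 (stable_of_tendsto (Ultrafilter.of l) (hφ.filter_mono hg) h0 (h.mono_left hg)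
    (X := X) ?_ ?_ hL hfix (hocc.mono_left hg) hlt)
  · filter_upwards [hφ'.filter_mono hg, hZ.filter_mono hg, hX.filter_mono hg] with k h1 h2 h3
    rw [h3]
    exact fun y ζ θ hc hθ => (h2 y ζ θ hc hθ).rateMap h1.blocks hc hθ
  · have h1 := tendsto_rateMap (A₂ := D.A2) (tendsto_A0 (hφ'.filter_mono hg) h0 (h.mono_left hg))
      (tendsto_A1 (hφ'.filter_mono hg) h0 (h.mono_left hg)) hZL
    rw [← hfix] at h1
    exact h1.congr' ((hX.filter_mono hg).mono fun k hk => hk.symm)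

/-! ### Convergence of the algorithms -/

lemma IsLoad.of_exactSteps {u : ℕ → D.Vec} (h0 : D.IsLoad (u 0))
    (hu : ∀ m, D.ExactStep (u m) (u (m + 1))) (m : ℕ) : D.IsLoad (u m) := by
  induction m with
  | zero => exact h0
  | succ m ih =>
    rw [(ih.exactStep_iff.1 (hu m)).2]
    exact ih.isLoad_exact (hu m).1

/-- For small `δ` the passes of the algorithm follow the exact passes over any finite horizon. -/
lemma tendsto_step_iterate {u : ℕ → D.Vec} (h0 : D.IsLoad (u 0))
    (hu : ∀ m, D.ExactStep (u m) (u (m + 1))) (j : ℕ) :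
    (∀ᶠ δ in 𝓝[>] (0 : ℝ), D.IsLoad ((D.step δ)^[j] (u 0))) ∧
      Tendsto (fun δ => (D.step δ)^[j] (u 0)) (𝓝[>] 0) (𝓝 (u j)) := by
  induction j with
  | zero => exact ⟨Eventually.of_forall fun _ => h0, tendsto_const_nhds⟩
  | succ j ih =>
    have hj := h0.of_exactSteps hu j
    simp only [Function.iterate_succ_apply']
    constructor
    · filter_upwards [ih.1, eventually_stable ih.1 hj ih.2 (hu j).1] with δ h1 h2
      exact (h1.step_spec h2 δ).1
    · rw [(hj.exactStep_iff.1 (hu j)).2]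
      exact tendsto_step ih.1 hj ih.2 self_mem_nhdsWithin nhdsWithin_le_nhds (hu j).1

/-- If the stopping criterion holds after some stable passes, the algorithm returns no later. -/
lemma Returns.of_close {ε δ : ℝ} (m : ℕ) (φ : D.Vec)
    (hs : ∀ j ≤ m, D.Stable ((D.step δ)^[j] φ))
    (hm : D.Close ε ((D.step δ)^[m] φ) ((D.step δ)^[m + 1] φ)) :
    ∃ j ≤ m, D.Close ε ((D.step δ)^[j] φ) ((D.step δ)^[j + 1] φ) ∧
      Returns D ε δ φ (Outcome.solved (D.rAlg ((D.step δ)^[j] φ) δ) ((D.step δ)^[j + 1] φ)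
        (1 - ∑ i, (D.step δ)^[j + 1] φ i)) := by
  by_cases hc : D.Close ε φ (D.step δ φ)
  · exact ⟨0, Nat.zero_le _, hc, Returns.halt φ (hs 0 (Nat.zero_le _)) hc⟩
  · induction m generalizing φ with
    | zero => exact absurd hm hc
    | succ m ih =>
      have hs' : ∀ j ≤ m, D.Stable ((D.step δ)^[j] (D.step δ φ)) := fun j hj =>
        hs (j + 1) (by omega)
      by_cases hc' : D.Close ε (D.step δ φ) (D.step δ (D.step δ φ))
      · exact ⟨1, by omega, hc', Returns.next φ _ (hs 0 (Nat.zero_le _)) hc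
          (Returns.halt _ (hs 1 (by omega)) hc')⟩
      · obtain ⟨j, hj, h1, h2⟩ := ih (D.step δ φ) hs' hm hc'
        exact ⟨j + 1, by omega, h1, Returns.next φ _ (hs 0 (Nat.zero_le _)) hc h2⟩

lemma Returns.exists_last {ε δ : ℝ} {φ : D.Vec} {out : Outcome D} (h : Returns D ε δ φ out)
    {R : D.Mat} {ψ : D.Vec} {x₀ : ℝ} (ho : out = Outcome.solved R ψ x₀) (hφ : D.IsLoad φ) :
    ∃ χ : D.Vec, D.IsLoad χ ∧ D.Stable χ ∧ D.Close ε χ ψ ∧ R = D.rAlg χ δ ∧ ψ = D.step δ χ ∧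
      x₀ = 1 - ∑ j, ψ j := by
  induction h with
  | unstable φ h => cases ho
  | halt φ h hc =>
    cases ho
    exact ⟨φ, hφ, h, hc, rfl, rfl, rfl⟩
  | next φ out h hc hr ih => exact ih ho (hφ.step_spec h δ).1

/-- Small increments occur only late in the sequence of exact passes, or after it has reached its
limit. -/
lemma exists_increment_bound {u : ℕ → D.Vec} {φ : D.Vec} (h0 : D.IsLoad (u 0))
    (hu : ∀ m, D.ExactStep (u m) (u (m + 1))) (hlim : Tendsto u atTop (𝓝 φ)) {τ : ℝ} (hτ : 0 < τ) :
    ∃ ε₀ : ℝ, 0 < ε₀ ∧ ∀ j, (∀ i, |u (j + 1) i - u j i| < ε₀) → dist (u (j + 1)) φ < τ := by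
  obtain ⟨J, hJ⟩ := Metric.tendsto_atTop.1 hlim τ hτ
  have hconst : ∀ j, u (j + 1) = u j → u (j + 1) = φ := by
    intro j hj
    have hk : ∀ k, u (j + k) = u j := by
      intro k
      induction k with
      | zero => rfl
      | succ k ih =>
        have h1 := ((h0.of_exactSteps hu (j + k)).exactStep_iff.1 (hu (j + k))).2
        rw [ih, ← ((h0.of_exactSteps hu j).exactStep_iff.1 (hu j)).2] at h1
        exact h1.trans hj
    rw [hj]
    refine tendsto_nhds_unique (tendsto_const_nhds (f := (atTop : Filter ℕ))) ?_
    refine ((tendsto_add_atTop_iff_nat j).2 hlim).congr fun k => ?_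
    rw [add_comm, hk]
  have hfin : ∀ J : ℕ, ∃ ε₀ : ℝ, 0 < ε₀ ∧
      ∀ j < J, (∀ i, |u (j + 1) i - u j i| < ε₀) → u (j + 1) = φ := by
    intro J
    induction J with
    | zero => exact ⟨1, one_pos, fun j hj => absurd hj (Nat.not_lt_zero j)⟩
    | succ J ih =>
      obtain ⟨e, he, h1⟩ := ih
      by_cases hJ : u (J + 1) = u J
      · refine ⟨e, he, fun j hj h => ?_⟩
        rcases Nat.lt_succ_iff_lt_or_eq.1 hj with h2 | rfl
        · exact h1 j h2 h
        · exact hconst j hJ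
      · obtain ⟨i, hi⟩ := Function.ne_iff.1 hJ
        refine ⟨min e |u (J + 1) i - u J i|, lt_min he (abs_pos.2 (sub_ne_zero.2 hi)),
          fun j hj h => ?_⟩
        rcases Nat.lt_succ_iff_lt_or_eq.1 hj with h2 | rfl
        · exact h1 j h2 fun i => (h i).trans_le (min_le_left _ _)
        · exact absurd ((h i).trans_le (min_le_right _ _)) (lt_irrefl _)
  obtain ⟨ε₀, hε, h1⟩ := hfin J
  refine ⟨ε₀, hε, fun j hj => ?_⟩
  rcases lt_or_ge j J with h2 | h2
  · rw [h1 j h2 hj, dist_self]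
    exact hτ
  · exact hJ (j + 1) (by omega)

lemma abs_sum_sub_lt {φ ψ : D.Vec} {τ : ℝ} (h : dist ψ φ < τ / (D.N + 1)) :
    |(1 - ∑ j, ψ j) - (1 - ∑ j, φ j)| < τ := by
  have hN : (0 : ℝ) < D.N + 1 := by positivity
  have h1 : (1 - ∑ j, ψ j) - (1 - ∑ j, φ j) = ∑ j, (φ j - ψ j) := by
    rw [Finset.sum_sub_distrib]; ring
  rw [h1]
  calc |∑ j, (φ j - ψ j)| ≤ ∑ j, |φ j - ψ j| := Finset.abs_sum_le_sum_abs _ _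
    _ ≤ ∑ _j : Fin (D.N + 1), dist ψ φ := Finset.sum_le_sum fun j _ => by
        rw [abs_sub_comm, ← Real.dist_eq]
        exact dist_le_pi_dist ψ φ j
    _ = (D.N + 1) * dist ψ φ := by simp
    _ < τ := by rwa [lt_div_iff₀ hN, mul_comm] at h

lemma isSteadyState_or_of_exactSteps {u : ℕ → D.Vec} {φ : D.Vec} (h0 : D.IsLoad (u 0))
    (hu : ∀ m, D.ExactStep (u m) (u (m + 1))) (hlim : Tendsto u atTop (𝓝 φ)) :
    D.IsSteadyState (1 - ∑ j, φ j) φ ∨ (∑ j, φ j = 1 ∧ ¬ D.Stable φ) := by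
  have hload := h0.of_exactSteps hu
  have hev : ∀ᶠ m in atTop, D.IsLoad (u m) := Eventually.of_forall hload
  have hφ := isLoad_of_tendsto hev hlim
  have hstep : ∀ m, u (m + 1) = D.occ (u m) (D.rateMatrix (u m)) := fun m =>
    ((hload m).exactStep_iff.1 (hu m)).2
  have hlim' := (tendsto_add_atTop_iff_nat 1).2 hlim
  by_cases hs : D.Stable φ
  · left
    rw [hφ.isSteadyState_iff, hφ.exactStep_iff]
    exact ⟨⟨hs, tendsto_nhds_unique hlim'
      ((tendsto_exact hev hφ hlim hs).congr fun m => (hstep m).symm)⟩, rfl⟩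
  · right
    refine ⟨(stable_or_sum_eq_one (Z := fun m => D.rateMatrix (u m))
      (X := fun m => D.rateMatrix (u m))
      (Eventually.of_forall fun m => ⟨hload m, (hu m).1⟩) hlim
      (Eventually.of_forall fun m => (hload m).certified_rateMatrix)
      (Eventually.of_forall fun m => (hload m).rateMatrix_fixed) (fun i j => ?_)
      (hlim'.congr hstep)).resolve_left hs, hs⟩
    exact tendsto_const_nhds.congr fun m =>
      (sub_eq_zero.2 (congrFun (congrFun (hload m).rateMatrix_fixed i) j).symm).symm

/-- The stopping rule is discontinuous in the iterates, so `ε` is taken below all increments of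
the early exact passes; then `δ` is taken so small that the inexact passes stop at a late one. -/
lemma exists_returns_near {u : ℕ → D.Vec} {φ : D.Vec} (h0 : D.IsLoad (u 0))
    (hu : ∀ m, D.ExactStep (u m) (u (m + 1))) (hlim : Tendsto u atTop (𝓝 φ)) {τ : ℝ} (hτ : 0 < τ) :
    ∃ ε₀ : ℝ, 0 < ε₀ ∧ ∀ ε : ℝ, 0 < ε → ε < ε₀ →
      ∃ δ₀ : ℝ, 0 < δ₀ ∧ ∀ δ : ℝ, 0 < δ → δ < δ₀ →
        ∃ (R : D.Mat) (ψ : D.Vec) (x₀ : ℝ),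
          Returns D ε δ (u 0) (Outcome.solved R ψ x₀) ∧
          (∀ j, |ψ j - φ j| < τ) ∧ |x₀ - (1 - ∑ j, φ j)| < τ := by
  have hN : (0 : ℝ) < D.N + 1 := by positivity
  have hτ' : 0 < τ / (D.N + 1) / 2 := by positivity
  obtain ⟨ε₀, hε₀, hinc⟩ := exists_increment_bound h0 hu hlim hτ'
  refine ⟨ε₀, hε₀, fun ε hε hlt => ?_⟩
  obtain ⟨m, hm⟩ : ∃ m, ∀ i, |u (m + 1) i - u m i| < ε := by
    have hev : ∀ᶠ m in atTop, ∀ i, |u (m + 1) i - u m i| < ε := by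
      refine eventually_all.2 fun i => ?_
      have h1 := tendsto_pi_nhds.1 hlim i
      have h2 := (((tendsto_add_atTop_iff_nat 1).2 h1).sub h1).abs
      rw [sub_self, abs_zero] at h2
      exact h2.eventually_lt_const hε
    exact hev.exists
  have hit := tendsto_step_iterate h0 hu
  have hdiff : ∀ j i, Tendsto (fun δ => |(D.step δ)^[j + 1] (u 0) i - (D.step δ)^[j] (u 0) i|)
      (𝓝[>] 0) (𝓝 |u (j + 1) i - u j i|) := fun j i =>
    ((tendsto_pi_nhds.1 (hit (j + 1)).2 i).sub (tendsto_pi_nhds.1 (hit j).2 i)).abs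
  have hgood : ∀ j, ∀ᶠ δ in 𝓝[>] (0 : ℝ), D.Stable ((D.step δ)^[j] (u 0)) ∧
      (D.Close ε ((D.step δ)^[j] (u 0)) ((D.step δ)^[j + 1] (u 0)) →
        dist ((D.step δ)^[j + 1] (u 0)) φ < τ / (D.N + 1)) := by
    intro j
    refine (eventually_stable (hit j).1 (h0.of_exactSteps hu j) (hit j).2 (hu j).1).and ?_
    by_cases hj : ∀ i, |u (j + 1) i - u j i| < ε₀
    · have h1 := hinc j hj
      filter_upwards [Metric.tendsto_nhds.1 (hit (j + 1)).2 _ hτ'] with δ h2 _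
      calc _ ≤ dist ((D.step δ)^[j + 1] (u 0)) (u (j + 1)) + dist (u (j + 1)) φ :=
            dist_triangle _ _ _
        _ < τ / (D.N + 1) / 2 + τ / (D.N + 1) / 2 := add_lt_add h2 h1
        _ = _ := add_halves _
    · push Not at hj
      obtain ⟨i, hi⟩ := hj
      filter_upwards [(hdiff j i).eventually_const_lt (hlt.trans_le hi)] with δ h1 hc
      exact absurd (hc i) h1.not_gt
  have hclose : ∀ᶠ δ in 𝓝[>] (0 : ℝ),
      D.Close ε ((D.step δ)^[m] (u 0)) ((D.step δ)^[m + 1] (u 0)) :=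
    eventually_all.2 fun i => (hdiff m i).eventually_lt_const (hm i)
  have hall : ∀ᶠ δ in 𝓝[>] (0 : ℝ), ∀ j ∈ Finset.range (m + 1), _ :=
    (Finset.eventually_all _).2 fun j _ => hgood j
  obtain ⟨δ₀, hδ₀, hsub⟩ := mem_nhdsGT_iff_exists_Ioo_subset.1 (hclose.and hall)
  refine ⟨δ₀, hδ₀, fun δ hδ hδlt => ?_⟩
  obtain ⟨h1, h2⟩ := hsub ⟨hδ, hδlt⟩
  obtain ⟨j, hj, h3, h4⟩ := Returns.of_close m (u 0)
    (fun j hj => (h2 j (Finset.mem_range_succ_iff.2 hj)).1) h1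
  have h5 := (h2 j (Finset.mem_range_succ_iff.2 hj)).2 h3
  refine ⟨_, _, _, h4, fun i => ?_, abs_sum_sub_lt h5⟩
  rw [← Real.dist_eq]
  exact (dist_le_pi_dist _ _ i).trans_lt (h5.trans_le (div_le_self hτ.le (by simp)))

lemma limit_of_returns {ε δ : ℕ → ℝ} {u φ : ℕ → D.Vec} {R : ℕ → D.Mat} {x₀ : ℕ → ℝ} {φ' : D.Vec}
    (h : ∀ k, 0 < ε k ∧ 0 < δ k ∧ D.IsLoad (u k) ∧
      Returns D (ε k) (δ k) (u k) (Outcome.solved (R k) (φ k) (x₀ k)))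
    (hε : Tendsto ε atTop (𝓝 0)) (hδ : Tendsto δ atTop (𝓝 0)) (hφ : Tendsto φ atTop (𝓝 φ')) :
    Tendsto x₀ atTop (𝓝 (1 - ∑ j, φ' j)) ∧
      ((D.IsSteadyState (1 - ∑ j, φ' j) φ' ∧
          ∃ R' : D.Mat, D.IsRMatrix φ' R' ∧
            ∀ i j, Tendsto (fun k => R k i j) atTop (𝓝 (R' i j))) ∨
        (∑ j, φ' j = 1 ∧ ¬ D.Stable φ')) := by
  choose χ hχ hst hcl hR hφχ hx using fun k => (h k).2.2.2.exists_last rfl (h k).2.2.1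
  have hχlim : Tendsto χ atTop (𝓝 φ') := by
    refine tendsto_pi_nhds.2 fun j => ?_
    have h1 : Tendsto (fun k => φ k j - χ k j) atTop (𝓝 0) :=
      squeeze_zero_norm (fun k => (hcl k j).le) hε
    simpa using (tendsto_pi_nhds.1 hφ j).sub h1
  have hev : ∀ᶠ k in atTop, D.IsLoad (χ k) := Eventually.of_forall hχ
  have hδpos : ∀ᶠ k in atTop, 0 < δ k := Eventually.of_forall fun k => (h k).2.1
  have h0 := isLoad_of_tendsto hev hχlim
  constructor
  · rw [funext hx]
    exact (tendsto_finsetSum _ fun j _ => tendsto_pi_nhds.1 hφ j).const_sub 1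
  · by_cases hs : D.Stable φ'
    · left
      refine ⟨?_, _, h0.isRMatrix, ?_⟩
      · rw [h0.isSteadyState_iff, h0.exactStep_iff]
        exact ⟨⟨hs, tendsto_nhds_unique hφ ((tendsto_step hev h0 hχlim hδpos hδ hs).congr
          fun k => (hφχ k).symm)⟩, rfl⟩
      · rw [funext hR]
        exact tendsto_matrix.1 (tendsto_rAlg hev h0 hχlim hδpos hδ hs)
    · right
      exact ⟨(stable_or_sum_eq_one
        (Z := fun k => D.rIter (χ k) (sInf {m | D.RStops (χ k) (δ k) m}))
        (X := fun k => D.rAlg (χ k) (δ k)) (Eventually.of_forall fun k => ⟨hχ k, hst k⟩) hχlim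
        (Eventually.of_forall fun k => (hχ k).certified_rIter _)
        (Eventually.of_forall fun k => rfl) (tendsto_rIter_defect hev hδpos hδ)
        (hφ.congr hφχ)).resolve_left hs, hs⟩

end Network

end SCUL

theorem theorem1 (D : SCUL.Network) :
    -- the success probabilities, and the stability check, at an arbitrary occupancy vector
    (∀ φ : D.Vec, D.IsLoad φ →
      HasSum (SCUL.cellPMF D.lam (φ 0 * D.muZ)) 1 ∧
      Summable (fun n : ℕ => SCUL.cellPMF D.lam (φ 0 * D.muZ) n * D.condRA (φ 0) n) ∧
      D.pRA (φ 0) ∈ Set.Ioc (0 : ℝ) 1 ∧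
      D.pTx ∈ Set.Ioo (0 : ℝ) 1 ∧
      D.pAval φ ∈ Set.Ioc (0 : ℝ) 1 ∧
      (∀ v : D.Vec, (v ᵥ* (D.A0 φ + D.A1 φ + D.A2) = v ∧ v ⬝ᵥ 1 = 1) ↔ v = D.nu φ) ∧
      (D.Stable φ ↔ ∃ x, D.IsStationary φ x)) ∧
    -- one pass of the algorithm after a successful check
    (∀ φ : D.Vec, D.IsLoad φ → D.Stable φ →
      (∀ δ : ℝ, 0 < δ → ∃ m, D.RStops φ δ m) ∧
      (∀ δ : ℝ, 0 < δ → D.IsLoad (D.step δ φ) ∧ 0 < 1 - ∑ j, D.step δ φ j) ∧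
      ∃ R : D.Mat, D.IsRMatrix φ R ∧
        (∀ i j, Tendsto (fun m => D.rIter φ m i j) atTop (𝓝 (R i j))) ∧
        (∀ i j, Tendsto (fun δ => D.rAlg φ δ i j) (𝓝[>] 0) (𝓝 (R i j))) ∧
        (∀ j, Tendsto (fun δ => D.step δ φ j) (𝓝[>] 0) (𝓝 (D.occ φ R j))) ∧
        IsUnit (1 - R).det ∧ IsUnit (D.bdry φ R).det ∧
        D.IsLoad (D.occ φ R) ∧
        0 < D.idle φ R ∧
        D.idle φ R = 1 - ∑ j, D.occ φ R j ∧
        ∃ x : D.State → ℝ, D.IsStationary φ x ∧ (∀ y, D.IsStationary φ y → y = x) ∧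
          x none = D.idle φ R ∧
          (∀ (i : ℕ) (j), x (some (i, j)) = (D.level1 φ R ᵥ* R ^ i) j) ∧
          (∀ j, HasSum (fun i : ℕ => x (some (i, j))) (D.occ φ R j))) ∧
    -- the steady states of a generic device are exactly the fixed points of the exact iteration
    (∀ (x₀ : ℝ) (φ : D.Vec), D.IsLoad φ →
      (D.IsSteadyState x₀ φ ↔ D.ExactStep φ φ ∧ x₀ = 1 - ∑ j, φ j)) ∧
    -- when the exact iteration converges, its limit is a steady state unless it lies on the
    -- boundary of the stability region, and the algorithm terminates and returns its limit up to
    -- an arbitrarily small error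
    (∀ (u : ℕ → D.Vec) (φ : D.Vec), D.IsLoad (u 0) →
      (∀ m, D.ExactStep (u m) (u (m + 1))) → Tendsto u atTop (𝓝 φ) →
      (D.IsSteadyState (1 - ∑ j, φ j) φ ∨ (∑ j, φ j = 1 ∧ ¬ D.Stable φ)) ∧
      ∀ τ : ℝ, 0 < τ → ∃ ε₀ : ℝ, 0 < ε₀ ∧ ∀ ε : ℝ, 0 < ε → ε < ε₀ →
        ∃ δ₀ : ℝ, 0 < δ₀ ∧ ∀ δ : ℝ, 0 < δ → δ < δ₀ →
          ∃ (R : D.Mat) (ψ : D.Vec) (x₀ : ℝ),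
            SCUL.Network.Returns D ε δ (u 0) (SCUL.Network.Outcome.solved R ψ x₀) ∧
            (∀ j, |ψ j - φ j| < τ) ∧ |x₀ - (1 - ∑ j, φ j)| < τ) ∧
    -- whatever the algorithm returns approximates a steady state as the tolerances vanish, unless
    -- the returned idle probability vanishes
    (∀ (ε δ : ℕ → ℝ) (u φ : ℕ → D.Vec) (R : ℕ → D.Mat) (x₀ : ℕ → ℝ) (φ' : D.Vec),
      (∀ k, 0 < ε k ∧ 0 < δ k ∧ D.IsLoad (u k) ∧
        SCUL.Network.Returns D (ε k) (δ k) (u k)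
          (SCUL.Network.Outcome.solved (R k) (φ k) (x₀ k))) →
      Tendsto ε atTop (𝓝 0) → Tendsto δ atTop (𝓝 0) → Tendsto φ atTop (𝓝 φ') →
      Tendsto x₀ atTop (𝓝 (1 - ∑ j, φ' j)) ∧
      ((D.IsSteadyState (1 - ∑ j, φ' j) φ' ∧
          ∃ R' : D.Mat, D.IsRMatrix φ' R' ∧
            ∀ i j, Tendsto (fun k => R k i j) atTop (𝓝 (R' i j))) ∨
        (∑ j, φ' j = 1 ∧ ¬ D.Stable φ'))) := by
  refine ⟨fun φ hφ => ?_, fun φ hφ hs => ?_, fun x₀ φ hφ => hφ.isSteadyState_iff,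
    fun u φ h0 hu hlim => ?_, fun ε δ u φ R x₀ φ' h hε hδ hφ => ?_⟩
  · exact ⟨SCUL.hasSum_cellPMF D.lam_pos (mul_nonneg (hφ.1 0) D.muZ_pos.le),
      D.summable_pRA (hφ.1 0), D.pRA_mem (hφ.1 0), D.pTx_mem, D.pAval_mem hφ, hφ.nu_iff,
      hφ.stable_iff_exists_stationary⟩
  · obtain ⟨y, ζ, θ, hc, hζ, hθ⟩ := hφ.exists_certificate hs
    have hR := hφ.certified_rateMatrix _ _ _ hc hθ.le
    have hδ0 : Tendsto (fun δ : ℝ => δ) (𝓝[>] 0) (𝓝 0) := nhdsWithin_le_nhds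
    have hδpos : ∀ᶠ δ : ℝ in 𝓝[>] 0, 0 < δ := self_mem_nhdsWithin
    have hload : ∀ᶠ _δ : ℝ in 𝓝[>] 0, D.IsLoad φ := Eventually.of_forall fun _ => hφ
    exact ⟨fun δ hδ => hφ.exists_rStops hδ, fun δ _ => hφ.step_spec hs δ, D.rateMatrix φ,
      hφ.isRMatrix, hφ.tendsto_rIter,
      SCUL.Network.tendsto_matrix.1
        (SCUL.Network.tendsto_rAlg hload hφ tendsto_const_nhds hδpos hδ0 hs),
      tendsto_pi_nhds.1 (SCUL.Network.tendsto_step hload hφ tendsto_const_nhds hδpos hδ0 hs),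
      hR.isUnit_det hc.pos hc.rate_pos.le hζ, SCUL.isUnit_det_boundary hφ.blocks hc hθ hR,
      SCUL.Network.isLoad_occ hφ hc hζ hθ hR, SCUL.Network.idle_pos hφ hc hζ hθ hR,
      SCUL.Network.idle_eq_one_sub hφ hc hζ hθ hR, _,
      SCUL.Network.isStationary_geometric hφ hc hζ hθ, fun x hx => hx.eq_geometric hφ hc hζ hθ,
      rfl, fun _ _ => rfl, SCUL.Network.hasSum_level1 hφ hc hζ hθ⟩
  · exact ⟨SCUL.Network.isSteadyState_or_of_exactSteps h0 hu hlim,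
      fun τ hτ => SCUL.Network.exists_returns_near h0 hu hlim hτ⟩
  · exact SCUL.Network.limit_of_returns h hε hδ hφ
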